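/- Fix a sequence of Tokunaga coefficients $T_k\ge 0$ $(k\ge 1)$ with $\limsup_{k\to\infty}T_k^{1/k}<\infty$ and parameters $p\in(0,1)$, $\gamma>0$, $\zeta>1$. Put $\pi_K=p(1-p)^{K-1}$ $(K\ge 1)$ and $\lambda_j=\gamma\,\zeta^{1-j}$ $(j\ge 1)$. A self-similar Random Attachment Model (RAM) basin with these parameters is the random rooted planted binary tree with edge lengths that is built as follows. The order $K$ is drawn from the distribution $(\pi_K)_{K\ge 1}$. Start with a single stream, which will have Horton–Strahler order $K$ in the final tree and has an exponential length with rate $\lambda_K$. Then, successively for $i=K-1,K-2,\dots,1$, add streams of final order $i$ to the current tree: on every link that will have order $j$ in the final tree take an independent homogeneous Poisson process with intensity $\lambda_jT_{j-i}$ and attach one new stream at each of its points, and attach two new streams at the upstream end of each source stream of the current tree; the lengths of all the new streams are independent exponential random variables with rate $\lambda_i$. Let $\operatorname{height}(T)$ be the length of the longest path from a source to the outlet (root) of the basin $T$, and let $\Lambda_k=\mathsf E\left[\operatorname{height}(T)\mid \operatorname{ord}(T)=k\right]$ be its mean in a basin of Horton–Strahler order $k$. Then $\Lambda_k<\infty$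 for every $k\ge 1$, and there is a constant $0<C<\infty$ such that $$\lim_{k\to\infty}\Lambda_k\,R_\Lambda^{-k}=C\qquad\text{with}\qquad R_\Lambda=\zeta .$$ -/

import Mathlib

open MeasureTheory ProbabilityTheory Filter Topology

/-- Finite rooted planted binary trees without edge lengths (non-empty ones). -/
inductive BasinShape : Type
  | source : BasinShape
  | junction (a b : BasinShape) : BasinShape

/-- Non-empty finite rooted planted binary trees with edge lengths: the root link has length `len`,
and its upstream end is either a source, or a junction at which the two basins `a`, `b` merge.
(The labelling of the two upstream basins as first and second plays no role below.) -/
inductive Basin : Type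
  | source (len : ℝ) : Basin
  | junction (len : ℝ) (a b : Basin) : Basin

namespace Basin

/-- The combinatorial projection. -/
def shape : Basin → BasinShape
  | source _ => .source
  | junction _ a b => .junction a.shape b.shape

/-- The length of the link with a given address; an address tells, junction by junction in the
upstream direction, which of the two basins to enter. The value is `0` if there is no such link. -/
def linkLength : Basin → List Bool → ℝ
  | source len, [] => len
  | source _, _ :: _ => 0
  | junction len _ _, [] => len
  | junction _ a _, false :: w => a.linkLength w
  | junction _ _ b, true :: w => b.linkLength w

/-- The σ-algebra generated by the combinatorial shape (a discrete, countable object) and the link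
lengths, i.e. the Borel σ-algebra of the disjoint union, over all shapes, of the spaces of vectors
of link lengths. -/
instance : MeasurableSpace Basin :=
  MeasurableSpace.comap shape ⊤ ⊔ MeasurableSpace.comap linkLength MeasurableSpace.pi

/-- The Horton-Strahler order of a basin, which is also the order of its root link. -/
def ord : Basin → ℕ
  | source _ => 1
  | junction _ a b => if a.ord = b.ord then a.ord + 1 else max a.ord b.ord

/-- The height: the length of the longest path from a source to the outlet. -/
def height : Basin → ℝ
  | source len => len
  | junction len a b => len + max a.height b.height

/-- Attach a new source stream of length `y` to the basin at distance `x` upstream from the outlet,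
along the path that starts with the root link and enters the second basin at each junction. The
link that contains the attachment point is cut in two at that point; the new stream becomes
the first of the two merging basins, so that the upstream piece of the link is again on the path
and further streams can be attached to the pieces of the same original link. -/
noncomputable def insertStream (x y : ℝ) : Basin → Basin
  | source len => junction x (source y) (source (len - x))
  | junction len a b =>
      if x < len then junction x (source y) (junction (len - x) a b)
      else junction len a (insertStream (x - len) y b)

end Basin

/-- The random basin obtained from `Basin.junction len a b` by attaching source streams to its root
link: the attachment points form a homogeneous Poisson process of intensity `intensity` on the link
(a Poisson number, with mean `intensity * len`, of independent uniform points), and the lengths of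
the streams are independent exponential variables with rate `rate`. -/
noncomputable def poissonAttach (intensity rate len : ℝ) (a b : Basin) : Measure Basin :=
  (poissonMeasure (intensity * len).toNNReal).bind fun n =>
    (Measure.pi fun _ : Fin n =>
        ((volume : Measure ℝ).restrict (Set.Icc 0 1)).prod (expMeasure rate)).map
      fun q => (List.ofFn q).foldl (fun t uy => t.insertStream (len * uy.1) uy.2)
        (Basin.junction len a b)

/-- One step of the Random Attachment Model with Tokunaga sequence `T` and stream rates `lam`:
the step that adds the streams which have order `i` in the final tree. A link of order `c` in the
current tree has order `c + i` in the final tree. To every such link, independently, streams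
are attached at the points of a Poisson process of intensity `lam (c + i) * T c`, and two streams
are added to each source of the current tree. All the added streams have independent exponential
lengths with rate `lam i`. -/
noncomputable def ramStep (T lam : ℕ → ℝ) (i : ℕ) : Basin → Measure Basin
  | .source len =>
      ((expMeasure (lam i)).prod (expMeasure (lam i))).bind fun y =>
        poissonAttach (lam (1 + i) * T 1) (lam i) len (.source y.1) (.source y.2)
  | .junction len a b =>
      ((ramStep T lam i a).prod (ramStep T lam i b)).bind fun s =>
        poissonAttach (lam ((Basin.junction len a b).ord + i) * T (Basin.junction len a b).ord)
          (lam i) len s.1 s.2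

/-- The law of the tree in the Random Attachment Model, when the main stream has order `i + n` in
the final tree and the streams of final orders `i + n, i + n - 1, …, i` have been added. -/
noncomputable def ramStage (T lam : ℕ → ℝ) : ℕ → ℕ → Measure Basin
  | 0, i => (expMeasure (lam i)).map Basin.source
  | n + 1, i => (ramStage T lam n (i + 1)).bind (ramStep T lam i)

/-- The Random Attachment Model with Tokunaga sequence `T 1, T 2, …`, stream rates
`lam 1, lam 2, …` and order distribution `π 1, π 2, …`: the law of a random basin whose order `K`
is drawn from `π`, and which is then built by adding the streams of orders `K, K - 1, …, 1`. -/
noncomputable def ramLaw (T lam π : ℕ → ℝ) : Measure Basin :=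
  Measure.sum fun n : ℕ => ENNReal.ofReal (π (n + 1)) • ramStage T lam n 1

/-- The law of the self-similar Random Attachment Model basin: geometric order distribution
`π K = p (1 - p) ^ (K - 1)` and stream rates `lam j = γ ζ ^ (1 - j)`. -/
noncomputable def selfSimilarRam (T : ℕ → ℝ) (γ ζ p : ℝ) : Measure Basin :=
  ramLaw T (fun j => γ * ζ ^ (1 - (j : ℤ))) (fun K => p * (1 - p) ^ (K - 1))

/-- `Λ_k = E [height | ord = k]`, the mean length of the longest stream in a self-similar Random
Attachment Model basin of order `k`. -/
noncomputable def meanHeight (T : ℕ → ℝ) (γ ζ p : ℝ) (k : ℕ) : ℝ :=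
  ∫ t, t.height ∂((selfSimilarRam T γ ζ p)[|{t : Basin | t.ord = k}])

open scoped ENNReal NNReal

/-! Given order `n + 1`, the basin has law `ramStage T lam n 1`, since the stage that starts from a
stream of order `n + 1` almost surely ends with that order. So the mean heights are the integrals `H
n = stageHeight T lam n`, and everything follows from a two-sided recursion for `H`.

Self-similarity: since `lam (i + 1) = lam i / ζ`, the law `ramStage T lam n 2` is that of `ramStage
T lam n 1` with all lengths multiplied by `ζ` (`lintegral_scale_ramStage`). A basin of order `n + 2`
therefore arises from a basin of mean height `ζ * H n` by one further step, which attaches streams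
with exponential lengths of rate `lam 1`. A step never lowers the height, so `ζ * H n ≤ H (n + 1)`.

For an upper bound, a step raises the height by at most the longest attached stream. The mean number
of attached streams, given the current tree, is at most twice a `weight` that counts sources and
adds up dominated Poisson intensities over links; tameness gives `T c ≤ A * B ^ c`, so the mean
weight grows at most like `R ^ n`. The mean excess of an exponential variable over a level `a` is
`exp (-lam 1 * a) / lam 1`; with `a = n * log R / lam 1` the factor `R ^ n` cancels
(`stageHeight_succ_le`). Hence `H (n + 1) ≤ ζ * H n + O(n + 1)`.

As `ζ > 1`, the sequence `H n * ζ⁻¹ ^ n` is monotone with summable increments, so it converges to a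
finite limit that is at least `H 0 > 0`. -/

/-! ### Measurability on the space of basins -/

theorem measurable_of_countable_cover {α β ι : Type*} [MeasurableSpace α] [MeasurableSpace β]
    [Countable ι] (p : α → ι) (hp : ∀ i, MeasurableSet (p ⁻¹' {i})) (f : α → β)
    (h : ∀ i, ∃ F : α → β, Measurable F ∧ ∀ a, p a = i → f a = F a) : Measurable f := by
  choose F hF hfF using h
  intro S hS
  have : f ⁻¹' S = ⋃ i, (p ⁻¹' {i} ∩ F i ⁻¹' S) := by
    ext a
    simp only [Set.mem_preimage, Set.mem_iUnion, Set.mem_inter_iff, Set.mem_singleton_iff]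
    constructor
    · intro ha
      exact ⟨p a, rfl, by rwa [← hfF _ a rfl]⟩
    · rintro ⟨i, hi, ha⟩
      rwa [hfF i a hi]
  rw [this]
  exact .iUnion fun i => (hp i).inter (hF i hS)

namespace BasinShape

instance : MeasurableSpace BasinShape := ⊤

instance : DiscreteMeasurableSpace BasinShape := ⟨fun _ => trivial⟩

/-- A prefix code for shapes. -/
def code : BasinShape → List Bool
  | source => [false]
  | junction a b => true :: (a.code ++ b.code)

/-- Unique decoding of a prefix code, with arbitrary tails so that the induction can peel off one
subtree at a time. It makes the set of shapes countable. -/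
theorem code_append_injective : ∀ (s t : BasinShape) (u v : List Bool),
    s.code ++ u = t.code ++ v → s = t ∧ u = v
  | source, source, u, v, h => by simpa [code] using h
  | source, junction _ _, u, v, h => by simp [code] at h
  | junction _ _, source, u, v, h => by simp [code] at h
  | junction a b, junction c d, u, v, h => by
    simp only [code, List.cons_append, List.append_assoc, List.cons.injEq, true_and] at h
    obtain ⟨hac, h'⟩ := code_append_injective a c _ _ h
    obtain ⟨hbd, huv⟩ := code_append_injective b d _ _ h'
    exact ⟨by rw [hac, hbd], huv⟩

instance : Countable BasinShape :=
  Function.Injective.countable (f := code) fun s t h =>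
    (code_append_injective s t [] [] (by simpa using h)).1

/-- The Horton-Strahler order of a shape. -/
def ord : BasinShape → ℕ
  | source => 1
  | junction a b => if a.ord = b.ord then a.ord + 1 else max a.ord b.ord

/-- The first of the two upstream shapes. -/
def left : BasinShape → BasinShape
  | source => source
  | junction a _ => a

/-- The second of the two upstream shapes. -/
def right : BasinShape → BasinShape
  | source => source
  | junction _ b => b

end BasinShape

namespace Basin

@[fun_prop]
theorem measurable_shape : Measurable shape :=
  Measurable.mono (comap_measurable shape) le_sup_left le_rfl

@[fun_prop]
theorem measurable_linkLength (w : List Bool) : Measurable fun t : Basin => t.linkLength w :=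
  (measurable_pi_apply w).comp
    (Measurable.mono (comap_measurable linkLength) le_sup_right le_rfl)

theorem measurable_of_shape_linkLength {α : Type*} [MeasurableSpace α] {f : α → Basin}
    (hs : Measurable fun a => (f a).shape) (hl : ∀ w, Measurable fun a => (f a).linkLength w) :
    Measurable f := by
  rw [measurable_iff_comap_le, instMeasurableSpace, MeasurableSpace.comap_sup,
    MeasurableSpace.comap_comp, MeasurableSpace.comap_comp, sup_le_iff]
  exact ⟨measurable_iff_comap_le.1 hs, measurable_iff_comap_le.1 (measurable_pi_lambda _ hl)⟩

@[fun_prop]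
theorem measurable_source : Measurable source :=
  measurable_of_shape_linkLength measurable_const fun w => by
    cases w with
    | nil => exact measurable_id
    | cons => exact measurable_const

theorem measurable_junction : Measurable fun q : ℝ × Basin × Basin => junction q.1 q.2.1 q.2.2 := by
  refine measurable_of_shape_linkLength ?_ fun w => ?_
  · have : Measurable fun q : BasinShape × BasinShape => BasinShape.junction q.1 q.2 :=
      .of_discrete
    exact this.comp (f := fun q : ℝ × Basin × Basin => (q.2.1.shape, q.2.2.shape)) (by fun_prop)
  · match w with
    | [] => exact measurable_fst
    | false :: w => exact (measurable_linkLength w).comp (measurable_fst.comp measurable_snd)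
    | true :: w => exact (measurable_linkLength w).comp (measurable_snd.comp measurable_snd)

@[fun_prop]
theorem _root_.Measurable.basin_junction {α : Type*} [MeasurableSpace α] {l : α → ℝ}
    {a b : α → Basin} (hl : Measurable l) (ha : Measurable a) (hb : Measurable b) :
    Measurable fun x => junction (l x) (a x) (b x) :=
  measurable_junction.comp (hl.prodMk (ha.prodMk hb))

/-- The length of the root link. -/
def rootLength : Basin → ℝ
  | source len => len
  | junction len _ _ => len

/-- The first of the two upstream basins. -/
def left : Basin → Basin
  | source len => source len
  | junction _ a _ => a

/-- The second of the two upstream basins. -/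
def right : Basin → Basin
  | source len => source len
  | junction _ _ b => b

@[fun_prop]
theorem measurable_rootLength : Measurable rootLength := by
  convert measurable_linkLength [] using 1
  ext t
  cases t <;> rfl

theorem measurableSet_shape_eq (s : BasinShape) : MeasurableSet (shape ⁻¹' {s}) :=
  measurable_shape (MeasurableSet.singleton s)

@[fun_prop]
theorem measurable_left : Measurable left := by
  refine measurable_of_shape_linkLength ?_ fun w => ?_
  · have : (fun t : Basin => t.left.shape) = fun t => t.shape.left := by
      ext t; cases t <;> rfl
    rw [this]
    exact (Measurable.of_discrete (f := BasinShape.left)).comp measurable_shape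
  · refine measurable_of_countable_cover shape measurableSet_shape_eq _ fun s => ?_
    match s with
    | .source =>
      refine ⟨fun t => t.linkLength w, measurable_linkLength w, fun t ht => ?_⟩
      cases t with
      | source => rfl
      | junction => simp [shape] at ht
    | .junction _ _ =>
      refine ⟨fun t => t.linkLength (false :: w), measurable_linkLength _, fun t ht => ?_⟩
      cases t with
      | source => simp [shape] at ht
      | junction => rfl

@[fun_prop]
theorem measurable_right : Measurable right := by
  refine measurable_of_shape_linkLength ?_ fun w => ?_
  · have : (fun t : Basin => t.right.shape) = fun t => t.shape.right := by
      ext t; cases t <;> rfl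
    rw [this]
    exact (Measurable.of_discrete (f := BasinShape.right)).comp measurable_shape
  · refine measurable_of_countable_cover shape measurableSet_shape_eq _ fun s => ?_
    match s with
    | .source =>
      refine ⟨fun t => t.linkLength w, measurable_linkLength w, fun t ht => ?_⟩
      cases t with
      | source => rfl
      | junction => simp [shape] at ht
    | .junction _ _ =>
      refine ⟨fun t => t.linkLength (true :: w), measurable_linkLength _, fun t ht => ?_⟩
      cases t with
      | source => simp [shape] at ht
      | junction => rfl

/-- Functions of a parameter and a basin that are defined by structural recursion on the basin
are measurable, if the two cases of the recursion are. -/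
theorem measurable_rec {P β : Type*} [MeasurableSpace P] [MeasurableSpace β] (f : P → Basin → β)
    (hs : ∃ F : P × ℝ → β, Measurable F ∧ ∀ p len, f p (source len) = F (p, len))
    (hj : ∀ s₁ s₂ : BasinShape, ∀ F₁ F₂ : P × Basin → β, Measurable F₁ → Measurable F₂ →
      ∃ G : P × Basin → β, Measurable G ∧ ∀ p len a b, a.shape = s₁ → b.shape = s₂ →
        (∀ q, F₁ (q, a) = f q a) → (∀ q, F₂ (q, b) = f q b) →
          f p (junction len a b) = G (p, junction len a b)) :
    Measurable fun q : P × Basin => f q.1 q.2 := by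
  refine measurable_of_countable_cover (fun q => q.2.shape)
    (fun s => measurable_snd (measurableSet_shape_eq s)) _ fun s => ?_
  -- On a fixed shape the recursion unfolds finitely often, so induction on the shape yields a
  -- measurable function that agrees with `f` there; the countably many shapes are then glued.
  induction s with
  | source =>
    obtain ⟨F, hF, h⟩ := hs
    refine ⟨fun q => F (q.1, q.2.rootLength), by fun_prop, ?_⟩
    rintro ⟨p, t⟩ ht
    cases t with
    | source => exact h _ _
    | junction => simp [shape] at ht
  | junction s₁ s₂ ih₁ ih₂ =>
    obtain ⟨F₁, hF₁, h₁⟩ := ih₁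
    obtain ⟨F₂, hF₂, h₂⟩ := ih₂
    obtain ⟨G, hG, h⟩ := hj s₁ s₂ F₁ F₂ hF₁ hF₂
    refine ⟨G, hG, ?_⟩
    rintro ⟨p, t⟩ ht
    cases t with
    | source => simp [shape] at ht
    | junction len a b =>
      simp only [shape, BasinShape.junction.injEq] at ht
      exact h p len a b ht.1 ht.2 (fun q => (h₁ (q, a) ht.1).symm) (fun q => (h₂ (q, b) ht.2).symm)

theorem ord_shape (t : Basin) : t.shape.ord = t.ord := by
  induction t with
  | source => rfl
  | junction len a b iha ihb => simp [ord, shape, BasinShape.ord, iha, ihb]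

@[fun_prop]
theorem measurable_ord : Measurable ord := by
  have : ord = fun t : Basin => t.shape.ord := funext fun t => (ord_shape t).symm
  rw [this]
  exact (Measurable.of_discrete (f := BasinShape.ord)).comp measurable_shape

@[fun_prop]
theorem measurable_height : Measurable height := by
  have := measurable_rec (P := Unit) (fun _ t => height t) ⟨fun q => q.2, by fun_prop, fun _ _ => rfl⟩
    fun s₁ s₂ F₁ F₂ h₁ h₂ =>
      ⟨fun q => q.2.rootLength + max (F₁ (q.1, q.2.left)) (F₂ (q.1, q.2.right)), by fun_prop,
        fun p len a b _ _ ha hb => by simp [height, rootLength, left, right, ha, hb]⟩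
  exact this.comp (f := fun t : Basin => ((), t)) (by fun_prop)

theorem measurable_insertStream :
    Measurable fun q : (ℝ × ℝ) × Basin => insertStream q.1.1 q.1.2 q.2 := by
  refine measurable_rec (fun p t => insertStream p.1 p.2 t)
    ⟨fun q => junction q.1.1 (source q.1.2) (source (q.2 - q.1.1)), by fun_prop, fun _ _ => rfl⟩
    fun s₁ s₂ F₁ F₂ h₁ h₂ =>
      ⟨fun q => if q.1.1 < q.2.rootLength then
          junction q.1.1 (source q.1.2) (junction (q.2.rootLength - q.1.1) q.2.left q.2.right)
        else junction q.2.rootLength q.2.left (F₂ ((q.1.1 - q.2.rootLength, q.1.2), q.2.right)),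
        Measurable.ite (measurableSet_lt (by fun_prop) (by fun_prop)) (by fun_prop) (by fun_prop),
        fun p len a b _ _ ha hb => by
          rw [insertStream]; simp only [rootLength, left, right, hb]⟩

@[fun_prop]
theorem _root_.Measurable.basin_insertStream {α : Type*} [MeasurableSpace α] {x y : α → ℝ}
    {t : α → Basin} (hx : Measurable x) (hy : Measurable y) (ht : Measurable t) :
    Measurable fun a => insertStream (x a) (y a) (t a) :=
  measurable_insertStream.comp ((hx.prodMk hy).prodMk ht)

end Basin

/-! ### Poisson variables and attachment marks -/

theorem lintegral_poissonMeasure (r : ℝ≥0) (f : ℕ → ℝ≥0∞) :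
    ∫⁻ n, f n ∂poissonMeasure r =
      ∑' n : ℕ, ENNReal.ofReal (Real.exp (-r) * r ^ n / n.factorial) * f n := by
  rw [poissonMeasure, lintegral_sum_measure]
  simp

theorem lintegral_natCast_poissonMeasure (r : ℝ≥0) :
    ∫⁻ n, (n : ℝ≥0∞) ∂poissonMeasure r = r := by
  have h1 : ∑' n : ℕ, ENNReal.ofReal (Real.exp (-r) * r ^ n / n.factorial) = 1 := by
    have := lintegral_poissonMeasure r 1
    simpa using this.symm
  rw [lintegral_poissonMeasure, tsum_eq_zero_add' ENNReal.summable]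
  have h2 : ∀ n : ℕ, ENNReal.ofReal (Real.exp (-r) * r ^ (n + 1) / (n + 1).factorial) *
      ((n + 1 : ℕ) : ℝ≥0∞) = r * ENNReal.ofReal (Real.exp (-r) * r ^ n / n.factorial) := by
    intro n
    rw [← ENNReal.ofReal_natCast, ← ENNReal.ofReal_coe_nnreal, ← ENNReal.ofReal_mul (by positivity),
      ← ENNReal.ofReal_mul (by positivity), Nat.factorial_succ]
    congr 1
    push_cast
    field_simp
    ring
  simp only [h2, ENNReal.tsum_mul_left, h1]
  simp

theorem poissonMeasure_zero : poissonMeasure 0 = Measure.dirac 0 := by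
  ext s hs
  rw [← lintegral_indicator_one hs, ← lintegral_indicator_one hs, lintegral_poissonMeasure,
    tsum_eq_single 0]
  · simp
  · intro n hn
    simp [hn]

/-- The law of an attachment point on a link of length `1` and of the length of the stream. -/
noncomputable def attachLaw (rate : ℝ) : Measure (ℝ × ℝ) :=
  ((volume : Measure ℝ).restrict (Set.Icc 0 1)).prod (expMeasure rate)

theorem isProbabilityMeasure_attachLaw {r : ℝ} (hr : 0 < r) :
    IsProbabilityMeasure (attachLaw r) := by
  have := isProbabilityMeasure_expMeasure hr
  have : IsProbabilityMeasure ((volume : Measure ℝ).restrict (Set.Icc 0 1)) := ⟨by simp⟩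
  unfold attachLaw
  infer_instance

namespace Basin

/-- Attach a list of streams at relative positions on a link of length `len`. -/
noncomputable def insertStreams (len : ℝ) (l : List (ℝ × ℝ)) (t : Basin) : Basin :=
  l.foldl (fun t uy => t.insertStream (len * uy.1) uy.2) t

theorem measurable_insertStreams (n : ℕ) :
    Measurable fun p : (ℝ × Basin) × (Fin n → ℝ × ℝ) =>
      insertStreams p.1.1 (List.ofFn p.2) p.1.2 := by
  induction n with
  | zero => simpa [insertStreams] using by fun_prop
  | succ n ih =>
    have : (fun p : (ℝ × Basin) × (Fin (n + 1) → ℝ × ℝ) =>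
        insertStreams p.1.1 (List.ofFn p.2) p.1.2) = fun p =>
        (fun p : (ℝ × Basin) × (Fin n → ℝ × ℝ) => insertStreams p.1.1 (List.ofFn p.2) p.1.2)
          ((p.1.1, p.1.2.insertStream (p.1.1 * (p.2 0).1) (p.2 0).2), fun i => p.2 i.succ) := by
      ext p
      simp [insertStreams, List.ofFn_succ]
    rw [this]
    refine ih.comp ?_
    fun_prop

theorem measurable_insertStreams_right (n : ℕ) (len : ℝ) (t : Basin) :
    Measurable fun q : Fin n → ℝ × ℝ => insertStreams len (List.ofFn q) t :=
  (measurable_insertStreams n).comp (f := fun q => ((len, t), q)) (by fun_prop)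

end Basin

open Basin

/-! ### Attachments, steps and stages as Markov kernels -/

theorem poissonAttach_eq_bind (ι r len : ℝ) (a b : Basin) :
    poissonAttach ι r len a b = (poissonMeasure (ι * len).toNNReal).bind fun n =>
      (Measure.pi fun _ : Fin n => attachLaw r).map
        fun q => insertStreams len (List.ofFn q) (.junction len a b) := rfl

theorem lintegral_poissonAttach (ι r len : ℝ) (a b : Basin) {f : Basin → ℝ≥0∞}
    (hf : Measurable f) :
    ∫⁻ s, f s ∂poissonAttach ι r len a b = ∫⁻ n, ∫⁻ q,
      f (insertStreams len (List.ofFn q) (.junction len a b))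
        ∂(Measure.pi fun _ : Fin n => attachLaw r) ∂poissonMeasure (ι * len).toNNReal := by
  rw [poissonAttach_eq_bind, Measure.lintegral_bind (Measurable.of_discrete).aemeasurable
    hf.aemeasurable]
  congr with n
  rw [lintegral_map hf (measurable_insertStreams_right n len _)]

theorem isProbabilityMeasure_poissonAttach (ι : ℝ) {r : ℝ} (hr : 0 < r) (len : ℝ) (a b : Basin) :
    IsProbabilityMeasure (poissonAttach ι r len a b) := by
  have := isProbabilityMeasure_attachLaw hr
  refine ⟨?_⟩
  have := lintegral_poissonAttach ι r len a b (f := 1) measurable_one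
  simpa using this

theorem measurable_poissonAttach (ι : ℝ) {r : ℝ} (hr : 0 < r) :
    Measurable fun q : ℝ × Basin × Basin => poissonAttach ι r q.1 q.2.1 q.2.2 := by
  have := isProbabilityMeasure_attachLaw hr
  refine Measure.measurable_of_measurable_coe _ fun S hS => ?_
  have : (fun q : ℝ × Basin × Basin => poissonAttach ι r q.1 q.2.1 q.2.2 S) = fun q =>
      ∑' n : ℕ, ENNReal.ofReal (Real.exp (-((ι * q.1).toNNReal : ℝ)) *
        ((ι * q.1).toNNReal : ℝ) ^ n / n.factorial) *
        ∫⁻ x, S.indicator 1 (insertStreams q.1 (List.ofFn x) (.junction q.1 q.2.1 q.2.2))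
          ∂(Measure.pi fun _ : Fin n => attachLaw r) := by
    ext q
    rw [← lintegral_indicator_one hS, lintegral_poissonAttach _ _ _ _ _
      (measurable_one.indicator hS), lintegral_poissonMeasure]
  rw [this]
  refine Measurable.tsum fun n => Measurable.mul (by fun_prop) ?_
  refine Measurable.lintegral_prod_right' (f := fun p : (ℝ × Basin × Basin) × (Fin n → ℝ × ℝ) =>
    S.indicator 1 (insertStreams p.1.1 (List.ofFn p.2) (.junction p.1.1 p.1.2.1 p.1.2.2))) ?_
  refine (measurable_one.indicator hS).comp ?_
  exact (measurable_insertStreams n).comp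
    (f := fun p : (ℝ × Basin × Basin) × (Fin n → ℝ × ℝ) =>
      ((p.1.1, .junction p.1.1 p.1.2.1 p.1.2.2), p.2)) (by fun_prop)

theorem Measurable.poissonAttach {α : Type*} [MeasurableSpace α] (ι : ℝ) {r : ℝ} (hr : 0 < r)
    {l : α → ℝ} {a b : α → Basin} (hl : Measurable l) (ha : Measurable a) (hb : Measurable b) :
    Measurable fun x => poissonAttach ι r (l x) (a x) (b x) := by
  have h := (measurable_poissonAttach ι hr).comp (hl.prodMk (ha.prodMk hb))
  simp only [Function.comp_def] at h
  exact h

/-- The recursion follows the tree, so measurability is proved shape by shape: with the shape fixed,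
the order in the intensity is a constant and the recursive calls are kernels by induction. -/
theorem exists_kernel_ramStep {T lam : ℕ → ℝ} {i : ℕ} (hlam : 0 < lam i) (s : BasinShape) :
    ∃ κ : Kernel Basin Basin, IsMarkovKernel κ ∧ ∀ t : Basin, t.shape = s →
      ramStep T lam i t = κ t := by
  have hexp := isProbabilityMeasure_expMeasure hlam
  induction s with
  | source =>
    have hm : Measurable fun q : Basin × ℝ × ℝ =>
        poissonAttach (lam (1 + i) * T 1) (lam i) q.1.rootLength (.source q.2.1) (.source q.2.2) :=
      .poissonAttach _ hlam (by fun_prop) (by fun_prop) (by fun_prop)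
    have hm' (t : Basin) : Measurable fun y : ℝ × ℝ =>
        poissonAttach (lam (1 + i) * T 1) (lam i) t.rootLength (.source y.1) (.source y.2) :=
      .poissonAttach _ hlam (by fun_prop) (by fun_prop) (by fun_prop)
    have hF : Measurable fun t : Basin => ((expMeasure (lam i)).prod (expMeasure (lam i))).bind
        fun y => poissonAttach (lam (1 + i) * T 1) (lam i) t.rootLength
          (.source y.1) (.source y.2) := by
      refine Measure.measurable_of_measurable_coe _ fun S hS => ?_
      simp_rw [Measure.bind_apply hS (hm' _).aemeasurable]
      exact ((Measure.measurable_coe hS).comp hm).lintegral_prod_right'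
    refine ⟨⟨_, hF⟩, ⟨fun t => ?_⟩, ?_⟩
    · have (y : ℝ × ℝ) := isProbabilityMeasure_poissonAttach (lam (1 + i) * T 1) hlam t.rootLength
        (.source y.1) (.source y.2)
      refine ⟨?_⟩
      rw [Kernel.coe_mk, Measure.bind_apply .univ (hm' _).aemeasurable]
      simp
    · intro t ht
      cases t with
      | source => rfl
      | junction => simp [shape] at ht
  | junction s₁ s₂ ih₁ ih₂ =>
    obtain ⟨κ₁, hκ₁, h₁⟩ := ih₁
    obtain ⟨κ₂, hκ₂, h₂⟩ := ih₂
    set c := (BasinShape.junction s₁ s₂).ord with hc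
    have hm : Measurable fun q : Basin × Basin × Basin =>
        poissonAttach (lam (c + i) * T c) (lam i) q.1.rootLength q.2.1 q.2.2 :=
      .poissonAttach _ hlam (by fun_prop) (by fun_prop) (by fun_prop)
    have hm' (t : Basin) : Measurable fun y : Basin × Basin =>
        poissonAttach (lam (c + i) * T c) (lam i) t.rootLength y.1 y.2 :=
      .poissonAttach _ hlam (by fun_prop) (by fun_prop) (by fun_prop)
    let κ : Kernel Basin (Basin × Basin) :=
      (κ₁.comap left measurable_left) ×ₖ (κ₂.comap right measurable_right)
    have hF : Measurable fun t : Basin => (κ t).bind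
        fun y => poissonAttach (lam (c + i) * T c) (lam i) t.rootLength y.1 y.2 := by
      refine Measure.measurable_of_measurable_coe _ fun S hS => ?_
      simp_rw [Measure.bind_apply hS (hm' _).aemeasurable]
      exact ((Measure.measurable_coe hS).comp hm).lintegral_kernel_prod_right'
    refine ⟨⟨_, hF⟩, ⟨fun t => ?_⟩, ?_⟩
    · have (y : Basin × Basin) := isProbabilityMeasure_poissonAttach (lam (c + i) * T c) hlam
        t.rootLength y.1 y.2
      refine ⟨?_⟩
      rw [Kernel.coe_mk, Measure.bind_apply .univ (hm' _).aemeasurable]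
      simp
    · intro t ht
      cases t with
      | source => simp [shape] at ht
      | junction len a b =>
        have hord : (Basin.junction len a b).ord = c := by rw [← ord_shape, ht]
        simp only [shape, BasinShape.junction.injEq] at ht
        rw [ramStep, hord, h₁ a ht.1, h₂ b ht.2]
        simp only [Kernel.coe_mk, κ, Kernel.prod_apply, Kernel.comap_apply, left, right, rootLength]

theorem isProbabilityMeasure_ramStep (T : ℕ → ℝ) {lam : ℕ → ℝ} {i : ℕ} (hlam : 0 < lam i)
    (t : Basin) : IsProbabilityMeasure (ramStep T lam i t) := by
  obtain ⟨κ, hκ, h⟩ := exists_kernel_ramStep (T := T) hlam t.shape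
  rw [h t rfl]
  infer_instance

theorem measurable_ramStep (T : ℕ → ℝ) {lam : ℕ → ℝ} {i : ℕ} (hlam : 0 < lam i) :
    Measurable (ramStep T lam i) :=
  measurable_of_countable_cover shape measurableSet_shape_eq _ fun s => by
    obtain ⟨κ, hκ, h⟩ := exists_kernel_ramStep (T := T) hlam s
    exact ⟨κ, κ.measurable, h⟩

theorem lintegral_ramStep_source (T : ℕ → ℝ) {lam : ℕ → ℝ} {i : ℕ} (hlam : 0 < lam i)
    (len : ℝ) {f : Basin → ℝ≥0∞} (hf : Measurable f) :
    ∫⁻ s, f s ∂ramStep T lam i (.source len) = ∫⁻ y₁, ∫⁻ y₂, ∫⁻ s, f s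
      ∂poissonAttach (lam (1 + i) * T 1) (lam i) len (.source y₁) (.source y₂)
        ∂expMeasure (lam i) ∂expMeasure (lam i) := by
  have hexp := isProbabilityMeasure_expMeasure hlam
  have hm : Measurable fun q : ℝ × ℝ =>
      poissonAttach (lam (1 + i) * T 1) (lam i) len (.source q.1) (.source q.2) :=
    .poissonAttach _ hlam (by fun_prop) (by fun_prop) (by fun_prop)
  rw [ramStep, Measure.lintegral_bind hm.aemeasurable hf.aemeasurable, lintegral_prod]
  exact ((Measure.measurable_lintegral hf).comp hm).aemeasurable

theorem lintegral_ramStep_junction (T : ℕ → ℝ) {lam : ℕ → ℝ} {i : ℕ} (hlam : 0 < lam i)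
    (len : ℝ) (a b : Basin) {f : Basin → ℝ≥0∞} (hf : Measurable f) :
    ∫⁻ s, f s ∂ramStep T lam i (.junction len a b) = ∫⁻ a', ∫⁻ b', ∫⁻ s, f s
      ∂poissonAttach (lam ((Basin.junction len a b).ord + i) * T (Basin.junction len a b).ord)
        (lam i) len a' b' ∂ramStep T lam i b ∂ramStep T lam i a := by
  have := isProbabilityMeasure_ramStep T hlam
  have hm : Measurable fun q : Basin × Basin =>
      poissonAttach (lam ((Basin.junction len a b).ord + i) * T (Basin.junction len a b).ord)
        (lam i) len q.1 q.2 :=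
    .poissonAttach _ hlam (by fun_prop) (by fun_prop) (by fun_prop)
  rw [ramStep, Measure.lintegral_bind hm.aemeasurable hf.aemeasurable, lintegral_prod]
  exact ((Measure.measurable_lintegral hf).comp hm).aemeasurable

theorem isProbabilityMeasure_ramStage (T : ℕ → ℝ) {lam : ℕ → ℝ} (hlam : ∀ i, 0 < lam i)
    (n i : ℕ) : IsProbabilityMeasure (ramStage T lam n i) := by
  induction n generalizing i with
  | zero =>
    have := isProbabilityMeasure_expMeasure (hlam i)
    exact Measure.isProbabilityMeasure_map measurable_source.aemeasurable
  | succ n ih =>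
    have := ih (i + 1)
    have := isProbabilityMeasure_ramStep T (hlam i)
    refine ⟨?_⟩
    rw [ramStage, Measure.bind_apply .univ (measurable_ramStep T (hlam i)).aemeasurable]
    simp

theorem lintegral_ramStage_succ (T : ℕ → ℝ) {lam : ℕ → ℝ} (n : ℕ) {i : ℕ} (hlam : 0 < lam i)
    {f : Basin → ℝ≥0∞} (hf : Measurable f) :
    ∫⁻ s, f s ∂ramStage T lam (n + 1) i =
      ∫⁻ t, ∫⁻ s, f s ∂ramStep T lam i t ∂ramStage T lam n (i + 1) := by
  rw [ramStage, Measure.lintegral_bind (measurable_ramStep T hlam).aemeasurable hf.aemeasurable]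

/-! ### Exponential lengths -/

theorem expMeasure_eq_withDensity (r : ℝ) :
    expMeasure r = volume.withDensity (exponentialPDF r) := rfl

theorem measurable_exponentialPDF (r : ℝ) : Measurable (exponentialPDF r) :=
  (measurable_exponentialPDFReal r).ennreal_ofReal

theorem lintegral_expMeasure (r : ℝ) {f : ℝ → ℝ≥0∞} (hf : Measurable f) :
    ∫⁻ y, f y ∂expMeasure r = ∫⁻ y, exponentialPDF r y * f y := by
  rw [expMeasure_eq_withDensity,
    lintegral_withDensity_eq_lintegral_mul _ (measurable_exponentialPDF r) hf]
  rfl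

theorem ae_nonneg_expMeasure (r : ℝ) : ∀ᵐ y ∂expMeasure r, 0 ≤ y := by
  rw [expMeasure_eq_withDensity, ae_withDensity_iff (measurable_exponentialPDF r)]
  refine .of_forall fun y hy => ?_
  by_contra h
  exact hy (exponentialPDF_of_neg (not_le.1 h))

theorem lintegral_ofReal_expMeasure {r : ℝ} (hr : 0 < r) :
    ∫⁻ y, ENNReal.ofReal y ∂expMeasure r = ENNReal.ofReal (1 / r) := by
  rw [lintegral_expMeasure r ENNReal.measurable_ofReal]
  -- The size-biased exponential density is `1 / r` times the Gamma density with shape `2`.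
  have h : ∀ y, exponentialPDF r y * ENNReal.ofReal y =
      ENNReal.ofReal (1 / r) * gammaPDF 2 r y := by
    intro y
    rcases lt_or_ge y 0 with hy | hy
    · rw [exponentialPDF_of_neg hy, gammaPDF_of_neg hy, zero_mul, mul_zero]
    · rw [exponentialPDF_of_nonneg hy, gammaPDF_of_nonneg hy,
        ← ENNReal.ofReal_mul (by positivity), ← ENNReal.ofReal_mul (by positivity)]
      congr 1
      rw [Real.Gamma_two]
      norm_num
      field_simp
  simp_rw [h]
  rw [lintegral_const_mul' _ _ ENNReal.ofReal_ne_top, lintegral_gammaPDF_eq_one two_pos hr, mul_one]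

/-- Memorylessness: shifting the variable by `a` takes the factor `exp (-(r * a))` out of the
density. -/
theorem lintegral_ofReal_sub_expMeasure {r a : ℝ} (hr : 0 < r) (ha : 0 ≤ a) :
    ∫⁻ y, ENNReal.ofReal (y - a) ∂expMeasure r =
      ENNReal.ofReal (Real.exp (-(r * a))) * ENNReal.ofReal (1 / r) := by
  rw [← lintegral_ofReal_expMeasure hr, lintegral_expMeasure r (by fun_prop),
    lintegral_expMeasure r (by fun_prop), ← lintegral_const_mul' _ _ ENNReal.ofReal_ne_top,
    ← lintegral_add_right_eq_self _ a]
  congr with y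
  rw [add_sub_cancel_right]
  rcases lt_or_ge y 0 with hy | hy
  · simp [ENNReal.ofReal_of_nonpos hy.le]
  · rw [exponentialPDF_of_nonneg hy, exponentialPDF_of_nonneg (by linarith), ← mul_assoc]
    congr 1
    rw [← ENNReal.ofReal_mul (by positivity)]
    congr 1
    rw [mul_add, neg_add, Real.exp_add]
    ring

theorem lintegral_attachLaw_snd {r : ℝ} (hr : 0 < r) {g : ℝ → ℝ≥0∞} (hg : Measurable g) :
    ∫⁻ p, g p.2 ∂attachLaw r = ∫⁻ y, g y ∂expMeasure r := by
  have := isProbabilityMeasure_expMeasure hr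
  rw [attachLaw, lintegral_prod _ (by fun_prop)]
  simp

/-- The strict bound matters: at relative position `1` the insertion would leave the link and enter
the second upstream basin. -/
theorem ae_attachLaw {r : ℝ} (hr : 0 < r) :
    ∀ᵐ p ∂attachLaw r, 0 ≤ p.1 ∧ p.1 < 1 ∧ 0 ≤ p.2 := by
  have := isProbabilityMeasure_expMeasure hr
  have h1 : ∀ᵐ u ∂((volume : Measure ℝ).restrict (Set.Icc 0 1)), 0 ≤ u ∧ u < 1 := by
    rw [← restrict_Ico_eq_restrict_Icc]
    exact (ae_restrict_mem measurableSet_Ico).mono fun u hu => hu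
  have h2 := (Measure.quasiMeasurePreserving_fst (ν := expMeasure r)).ae h1
  have h3 := (Measure.quasiMeasurePreserving_snd
    (μ := (volume : Measure ℝ).restrict (Set.Icc 0 1))).ae (ae_nonneg_expMeasure r)
  filter_upwards [h2, h3] with p h h' using ⟨h.1, h.2, h'⟩

/-! ### Repeated insertion on one link -/

namespace Basin

/-- `Attached a b len t`: the basin `t` arises from a junction of `a` and `b` by attaching source
streams to the root link, and the pieces of that link have total length `len`. -/
inductive Attached (a b : Basin) : ℝ → Basin → Prop
  | nil {len : ℝ} (hlen : 0 ≤ len) : Attached a b len (junction len a b)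
  | cons {x y len : ℝ} {t : Basin} (hx : 0 ≤ x) (hy : 0 ≤ y) (ht : Attached a b len t) :
      Attached a b (x + len) (junction x (source y) t)

theorem Attached.insertStream {a b t : Basin} {len : ℝ} (h : Attached a b len t) :
    ∀ {x y : ℝ}, 0 ≤ x → x < len → 0 ≤ y → Attached a b len (t.insertStream x y) := by
  induction h with
  | @nil len hlen =>
    intro x y hx hxl hy
    rw [Basin.insertStream, if_pos hxl]
    have := Attached.cons hx hy (Attached.nil (a := a) (b := b) (sub_nonneg.2 hxl.le))
    rwa [add_sub_cancel] at this
  | @cons x₀ y₀ len t hx₀ hy₀ ht ih =>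
    intro x y hx hxl hy
    rw [Basin.insertStream]
    split_ifs with hlt
    · have := Attached.cons hx hy (Attached.cons (sub_nonneg.2 hlt.le) hy₀ ht)
      rwa [← add_assoc, add_sub_cancel] at this
    · exact Attached.cons hx₀ hy₀ (ih (by linarith) (by linarith) hy)

/-- Telescoping of a one-insertion bound. It applies at each insertion because an insertion at
distance less than `len` preserves `Attached a b len`. -/
theorem Attached.le_insertStreams {a b : Basin} {len : ℝ} (hlen : 0 < len) {f : Basin → ℝ≥0∞}
    {g : ℝ → ℝ≥0∞} (h : ∀ t x y, Attached a b len t → 0 ≤ x → x < len → 0 ≤ y →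
      f (t.insertStream x y) ≤ f t + g y) (l : List (ℝ × ℝ))
    (hl : ∀ p ∈ l, 0 ≤ p.1 ∧ p.1 < 1 ∧ 0 ≤ p.2) {t : Basin} (ht : Attached a b len t) :
    f (insertStreams len l t) ≤ f t + (l.map fun p => g p.2).sum := by
  induction l generalizing t with
  | nil => simp [insertStreams]
  | cons p l ih =>
    obtain ⟨h0, h1, hy⟩ := hl p (by simp)
    have hx0 : 0 ≤ len * p.1 := by positivity
    have hx1 : len * p.1 < len := by nlinarith
    refine (ih (fun q hq => hl q (by simp [hq])) (ht.insertStream hx0 hx1 hy)).trans ?_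
    rw [List.map_cons, List.sum_cons, ← add_assoc]
    gcongr
    exact h t _ _ ht hx0 hx1 hy

end Basin

/-- Each point raises `f` by at most `g` of its stream length, and the Poisson number of points is
independent of the lengths, so the mean increase is at most mean number times mean cost. -/
theorem lintegral_poissonAttach_le {ι r len : ℝ} (hr : 0 < r) (hlen : 0 ≤ len)
    {a b : Basin} {f : Basin → ℝ≥0∞} (hf : Measurable f) {g : ℝ → ℝ≥0∞} (hg : Measurable g)
    (h : ∀ t x y, Attached a b len t → 0 ≤ x → x < len → 0 ≤ y →
      f (t.insertStream x y) ≤ f t + g y) :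
    ∫⁻ s, f s ∂poissonAttach ι r len a b ≤
      f (.junction len a b) + ENNReal.ofReal (ι * len) * ∫⁻ y, g y ∂expMeasure r := by
  have := isProbabilityMeasure_attachLaw hr
  rw [lintegral_poissonAttach _ _ _ _ _ hf]
  -- On a link of length zero no position satisfies `x < len`, but the Poisson number is then `0`.
  rcases hlen.eq_or_lt with rfl | hlen
  · simp [poissonMeasure_zero, insertStreams, lintegral_dirac]
  calc
    _ ≤ ∫⁻ n, (f (.junction len a b) + n * ∫⁻ y, g y ∂expMeasure r)
        ∂poissonMeasure (ι * len).toNNReal := by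
      refine lintegral_mono fun n => ?_
      have hae : ∀ᵐ q ∂(Measure.pi fun _ : Fin n => attachLaw r), ∀ i,
          0 ≤ (q i).1 ∧ (q i).1 < 1 ∧ 0 ≤ (q i).2 :=
        Filter.eventually_all.2 fun i =>
          (measurePreserving_eval (fun _ : Fin n => attachLaw r) i).quasiMeasurePreserving.ae
            (ae_attachLaw hr)
      calc
        _ ≤ ∫⁻ q, (f (.junction len a b) + ∑ i, g (q i).2)
            ∂(Measure.pi fun _ : Fin n => attachLaw r) := by
          refine lintegral_mono_ae ?_
          filter_upwards [hae] with q hq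
          refine (Attached.le_insertStreams hlen h (List.ofFn q) ?_ (.nil hlen.le)).trans_eq ?_
          · simpa [List.mem_ofFn] using hq
          · rw [List.map_ofFn, List.sum_ofFn]
            rfl
        _ = _ := by
          rw [lintegral_add_left measurable_const, lintegral_const, measure_univ, mul_one,
            lintegral_finsetSum _ (fun i _ => by fun_prop)]
          congr 1
          have hi : ∀ i : Fin n, ∫⁻ q, g (q i).2 ∂(Measure.pi fun _ : Fin n => attachLaw r) =
              ∫⁻ y, g y ∂expMeasure r := fun i => by
            rw [← lintegral_attachLaw_snd hr hg,
              ← (measurePreserving_eval (fun _ : Fin n => attachLaw r) i).lintegral_comp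
                (f := fun p => g p.2) (by fun_prop)]
          simp [hi]
    _ = _ := by
      rw [lintegral_add_left measurable_const, lintegral_const, measure_univ, mul_one,
        lintegral_mul_const _ .of_discrete, lintegral_natCast_poissonMeasure]
      rfl

/-- The previous bound for the indicator of the complement, with insertion cost `0`. -/
theorem ae_poissonAttach {ι r len : ℝ} (hr : 0 < r) (hlen : 0 ≤ len) {a b : Basin}
    {p : Basin → Prop} (hp : MeasurableSet {t | p t}) (h : p (.junction len a b))
    (hins : ∀ t x y, Attached a b len t → 0 ≤ x → x < len → 0 ≤ y → p t →
      p (t.insertStream x y)) :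
    ∀ᵐ s ∂poissonAttach ι r len a b, p s := by
  classical
  have := lintegral_poissonAttach_le (ι := ι) hr hlen (a := a) (b := b)
    (f := {t | p t}ᶜ.indicator 1) (measurable_one.indicator hp.compl) (g := 0) measurable_zero
    fun t x y ht hx hxl hy => by
      by_cases hpt : p t
      · simp [hins t x y ht hx hxl hy hpt]
      · simp only [Set.indicator, Set.mem_compl_iff, Set.mem_ofPred_eq, hpt, not_false_eq_true,
          if_true, Pi.one_apply, Pi.zero_apply, add_zero]
        split_ifs <;> simp
  rw [lintegral_indicator_one hp.compl] at this
  rw [ae_iff, ← Set.compl_ofPred]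
  simpa [h] using this

theorem ae_ramStep_source (T : ℕ → ℝ) {lam : ℕ → ℝ} {i : ℕ} (hlam : 0 < lam i) {len : ℝ}
    {p : Basin → Prop} (hp : MeasurableSet {t | p t})
    (h : ∀ᵐ y₁ ∂expMeasure (lam i), ∀ᵐ y₂ ∂expMeasure (lam i),
      ∀ᵐ s ∂poissonAttach (lam (1 + i) * T 1) (lam i) len (.source y₁) (.source y₂), p s) :
    ∀ᵐ s ∂ramStep T lam i (.source len), p s := by
  rw [ae_iff, ← Set.compl_ofPred, ← lintegral_indicator_one hp.compl,
    lintegral_ramStep_source T hlam _ (measurable_one.indicator hp.compl)]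
  simp only [lintegral_indicator_one hp.compl]
  rw [← lintegral_zero (μ := expMeasure (lam i))]
  refine lintegral_congr_ae ?_
  filter_upwards [h] with y₁ h₁
  rw [← lintegral_zero (μ := expMeasure (lam i))]
  refine lintegral_congr_ae ?_
  filter_upwards [h₁] with y₂ h₂ using ae_iff.1 h₂

theorem ae_ramStep_junction (T : ℕ → ℝ) {lam : ℕ → ℝ} {i : ℕ} (hlam : 0 < lam i) {len : ℝ}
    {a b : Basin} {p : Basin → Prop} (hp : MeasurableSet {t | p t})
    (h : ∀ᵐ a' ∂ramStep T lam i a, ∀ᵐ b' ∂ramStep T lam i b,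
      ∀ᵐ s ∂poissonAttach (lam ((Basin.junction len a b).ord + i) *
        T (Basin.junction len a b).ord) (lam i) len a' b', p s) :
    ∀ᵐ s ∂ramStep T lam i (.junction len a b), p s := by
  rw [ae_iff, ← Set.compl_ofPred, ← lintegral_indicator_one hp.compl,
    lintegral_ramStep_junction T hlam _ _ _ (measurable_one.indicator hp.compl)]
  simp only [lintegral_indicator_one hp.compl]
  rw [← lintegral_zero (μ := ramStep T lam i a)]
  refine lintegral_congr_ae ?_
  filter_upwards [h] with y₁ h₁
  rw [← lintegral_zero (μ := ramStep T lam i b)]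
  refine lintegral_congr_ae ?_
  filter_upwards [h₁] with y₂ h₂ using ae_iff.1 h₂

/-! ### Order, height and weight -/

namespace Basin

theorem one_le_ord (t : Basin) : 1 ≤ t.ord := by
  induction t with
  | source => simp [ord]
  | junction len a b iha ihb =>
    rw [ord]
    split_ifs <;> omega

theorem two_le_ord_junction (len : ℝ) (a b : Basin) : 2 ≤ (junction len a b).ord := by
  have := one_le_ord a
  have := one_le_ord b
  rw [ord]
  split_ifs <;> omega

theorem ord_junction_source {x y : ℝ} {t : Basin} (ht : 2 ≤ t.ord) :
    (junction x (source y) t).ord = t.ord := by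
  rw [ord, ord]
  split_ifs <;> omega

/-- A side stream of order `1` cannot change an order that is at least `2`. The length `l` is free
since orders ignore lengths. -/
theorem Attached.ord_eq {a b t : Basin} {len : ℝ} (h : Attached a b len t) (l : ℝ) :
    t.ord = (junction l a b).ord := by
  induction h with
  | nil => rfl
  | cons _ _ _ ih =>
    rw [ord_junction_source (ih ▸ two_le_ord_junction l a b), ih]

/-- All links have non-negative lengths. -/
def NonNeg (t : Basin) : Prop := ∀ w, 0 ≤ t.linkLength w

theorem measurableSet_nonNeg : MeasurableSet {t : Basin | t.NonNeg} := by
  have : {t : Basin | t.NonNeg} = ⋂ w, {t | 0 ≤ t.linkLength w} := by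
    ext t
    simp [NonNeg]
  rw [this]
  exact .iInter fun w => measurableSet_le measurable_const (measurable_linkLength w)

theorem nonNeg_source {len : ℝ} : (source len).NonNeg ↔ 0 ≤ len := by
  constructor
  · exact fun h => h []
  · intro h w
    cases w with
    | nil => exact h
    | cons => exact le_rfl

theorem nonNeg_junction {len : ℝ} {a b : Basin} :
    (junction len a b).NonNeg ↔ 0 ≤ len ∧ a.NonNeg ∧ b.NonNeg := by
  constructor
  · exact fun h => ⟨h [], fun w => h (false :: w), fun w => h (true :: w)⟩
  · rintro ⟨h, ha, hb⟩ w
    match w with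
    | [] => exact h
    | false :: w => exact ha w
    | true :: w => exact hb w

theorem NonNeg.height_nonneg {t : Basin} (h : t.NonNeg) : 0 ≤ t.height := by
  induction t with
  | source len => exact nonNeg_source.1 h
  | junction len a b iha ihb =>
    obtain ⟨hl, ha, hb⟩ := nonNeg_junction.1 h
    exact add_nonneg hl (le_max_of_le_left (iha ha))

theorem Attached.nonNeg {a b t : Basin} {len : ℝ} (h : Attached a b len t) (ha : a.NonNeg)
    (hb : b.NonNeg) : t.NonNeg := by
  induction h with
  | nil hlen => exact nonNeg_junction.2 ⟨hlen, ha, hb⟩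
  | cons hx hy _ ih => exact nonNeg_junction.2 ⟨hx, nonNeg_source.2 hy, ih⟩

/-- The new path has length `x + y` and cutting a link preserves all others. The identity is
algebraic, so no sign or range condition enters. -/
theorem height_insertStream (t : Basin) (x y : ℝ) :
    (t.insertStream x y).height = max t.height (x + y) := by
  induction t generalizing x with
  | source len =>
    simp only [insertStream, height]
    grind
  | junction len a b iha ihb =>
    rw [insertStream]
    split_ifs
    · simp only [height]
      grind
    · simp only [height, ihb]
      grind

/-- A weight of a basin: each source contributes `1`, and each link of order `c` contributes
`β c` times its length. -/
noncomputable def weight (β : ℕ → ℝ) : Basin → ℝ≥0∞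
  | source len => 1 + ENNReal.ofReal (β 1 * len)
  | junction len a b =>
      ENNReal.ofReal (β (junction len a b).ord * len) + (weight β a + weight β b)

@[fun_prop]
theorem measurable_weight (β : ℕ → ℝ) : Measurable (weight β) := by
  have := measurable_rec (P := Unit) (fun _ t => weight β t)
    ⟨fun q => 1 + ENNReal.ofReal (β 1 * q.2), by fun_prop, fun _ _ => rfl⟩
    fun s₁ s₂ F₁ F₂ h₁ h₂ =>
      ⟨fun q => ENNReal.ofReal (β (s₁.junction s₂).ord * q.2.rootLength) +
          (F₁ (q.1, q.2.left) + F₂ (q.1, q.2.right)), by fun_prop,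
        fun p len a b ha' hb' ha hb => by
          have : (junction len a b).ord = (s₁.junction s₂).ord := by
            rw [← ord_shape, shape, ha', hb']
          simp [weight, rootLength, left, right, ha, hb, this]⟩
  exact this.comp (f := fun t : Basin => ((), t)) (by fun_prop)

theorem weight_junction_source (β : ℕ → ℝ) (x y : ℝ) {t : Basin} (ht : 2 ≤ t.ord) :
    (junction x (source y) t).weight β =
      ENNReal.ofReal (β t.ord * x) + (1 + ENNReal.ofReal (β 1 * y) + t.weight β) := by
  rw [weight, ord_junction_source ht, weight]

/-- The two pieces of a cut link keep its order, and the link terms are linear in the length, so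
only the new source contributes. -/
theorem Attached.weight_insertStream {β : ℕ → ℝ} (hβ : ∀ c, 0 ≤ β c) {a b t : Basin} {len : ℝ}
    (h : Attached a b len t) : ∀ {x y : ℝ}, 0 ≤ x → x < len → 0 ≤ y →
      (t.insertStream x y).weight β = t.weight β + (1 + ENNReal.ofReal (β 1 * y)) := by
  have key : ∀ {c : ℕ} {x l : ℝ}, 0 ≤ x → x < l → ENNReal.ofReal (β c * l) =
      ENNReal.ofReal (β c * x) + ENNReal.ofReal (β c * (l - x)) := by
    intro c x l hx hl
    rw [← ENNReal.ofReal_add (mul_nonneg (hβ c) hx) (mul_nonneg (hβ c) (by linarith))]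
    congr 1
    ring
  induction h with
  | @nil len hlen =>
    intro x y hx hxl hy
    rw [Basin.insertStream, if_pos hxl,
      weight_junction_source _ _ _ (two_le_ord_junction (len - x) a b), weight, weight,
      show (junction (len - x) a b).ord = (junction len a b).ord from rfl, key hx hxl]
    ring
  | @cons x₀ y₀ len t hx₀ hy₀ ht ih =>
    intro x y hx hxl hy
    have h2 : 2 ≤ t.ord := ht.ord_eq 0 ▸ two_le_ord_junction 0 a b
    rw [Basin.insertStream, weight_junction_source _ _ _ h2]
    split_ifs with hlt
    · rw [weight_junction_source _ _ _ (two_le_ord_junction _ _ _), ord_junction_source h2,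
        weight_junction_source _ _ _ h2, key hx hlt]
      ring
    · have hx' : 0 ≤ x - x₀ := by linarith
      have hxl' : x - x₀ < len := by linarith
      have h3 := (ht.insertStream hx' hxl' hy).ord_eq 0
      rw [← ht.ord_eq 0] at h3
      rw [weight_junction_source _ _ _ (h3 ▸ h2), h3, ih hx' hxl' hy]
      ring

end Basin

/-! ### The effect of one step -/

theorem lintegral_lintegral_const_add_add {α β : Type*} [MeasurableSpace α] [MeasurableSpace β]
    (μ : Measure α) (ν : Measure β) [IsProbabilityMeasure μ] [IsProbabilityMeasure ν] (k : ℝ≥0∞)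
    (f : α → ℝ≥0∞) (g : β → ℝ≥0∞) :
    ∫⁻ x, ∫⁻ y, (k + (f x + g y)) ∂ν ∂μ = k + (∫⁻ x, f x ∂μ + ∫⁻ y, g y ∂ν) := by
  have h : ∀ x, ∫⁻ y, (k + (f x + g y)) ∂ν = k + (f x + ∫⁻ y, g y ∂ν) := fun x => by
    rw [lintegral_add_left measurable_const, lintegral_add_left measurable_const]
    simp
  simp_rw [h]
  rw [lintegral_add_left measurable_const, lintegral_add_right _ measurable_const]
  simp

/-- Two streams at each source raise the order by one and side streams leave it alone; extending
sources by non-negative lengths and inserting streams cannot shorten the longest path. -/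
theorem ae_ramStep (T : ℕ → ℝ) {lam : ℕ → ℝ} {i : ℕ} (hlam : 0 < lam i) {t : Basin}
    (ht : t.NonNeg) :
    ∀ᵐ s ∂ramStep T lam i t, s.NonNeg ∧ s.ord = t.ord + 1 ∧ t.height ≤ s.height := by
  have hmeas : ∀ (c : ℕ) (h : ℝ),
      MeasurableSet {s : Basin | s.NonNeg ∧ s.ord = c ∧ h ≤ s.height} := fun c h =>
    measurableSet_nonNeg.inter ((measurable_ord (MeasurableSet.singleton c)).inter
      (measurableSet_le measurable_const measurable_height))
  have hattach : ∀ (ι len : ℝ) (a b : Basin) (c : ℕ) (h : ℝ), 0 ≤ len → a.NonNeg → b.NonNeg →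
      (junction len a b).ord = c → h ≤ (junction len a b).height →
      ∀ᵐ s ∂poissonAttach ι (lam i) len a b, s.NonNeg ∧ s.ord = c ∧ h ≤ s.height := by
    intro ι len a b c h hlen ha hb hc hh
    refine ae_poissonAttach hlam hlen (hmeas c h) ⟨nonNeg_junction.2 ⟨hlen, ha, hb⟩, hc, hh⟩ ?_
    rintro s x y hs hx hxl hy ⟨-, -, hhs⟩
    have hs' := hs.insertStream hx hxl hy
    refine ⟨hs'.nonNeg ha hb, (hs'.ord_eq len).trans hc, ?_⟩
    rw [height_insertStream]
    exact le_max_of_le_left hhs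
  induction t with
  | source len =>
    have hlen := nonNeg_source.1 ht
    refine ae_ramStep_source T hlam (hmeas _ _) ?_
    filter_upwards [ae_nonneg_expMeasure (lam i)] with y₁ h₁
    filter_upwards [ae_nonneg_expMeasure (lam i)] with y₂ h₂
    refine hattach _ _ _ _ _ _ hlen (nonNeg_source.2 h₁) (nonNeg_source.2 h₂) rfl ?_
    simp only [height]
    linarith [le_max_left y₁ y₂]
  | junction len a b iha ihb =>
    obtain ⟨hlen, ha, hb⟩ := nonNeg_junction.1 ht
    refine ae_ramStep_junction T hlam (hmeas _ _) ?_
    filter_upwards [iha ha] with a' ha'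
    filter_upwards [ihb hb] with b' hb'
    refine hattach _ _ _ _ _ _ hlen ha'.1 hb'.1 ?_ ?_
    · rw [ord, ord, ha'.2.1, hb'.2.1]
      split_ifs <;> omega
    · rw [height, height]
      exact add_le_add_right (max_le_max ha'.2.2 hb'.2.2) len

/-- A branching estimate, with `β` dominating the intensities of this step and `β'` those of the
next. A new stream has mean weight at most `1 + D`. A source spawns two, which costs `2 + 2 * D`. A
link term `β c * len` becomes at most `B` times itself, because the order rises by one, plus `1 + D`
per attached stream. Both factors are at most `2 + 2 * D + B`. -/
theorem lintegral_weight_ramStep_le {T lam β β' : ℕ → ℝ} {i : ℕ} {B D : ℝ} (hlam : 0 < lam i)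
    (hβ : ∀ c, 0 ≤ β c) (hβ' : ∀ c, 0 ≤ β' c) (hB : 0 ≤ B) (hD : 0 ≤ D)
    (hT : ∀ c, 1 ≤ c → lam (c + i) * T c ≤ β c) (hββ' : ∀ c, 1 ≤ c → β' (c + 1) ≤ B * β c)
    (hβD : β' 1 ≤ D * lam i) {t : Basin} (ht : t.NonNeg) :
    ∫⁻ s, s.weight β' ∂ramStep T lam i t ≤ ENNReal.ofReal (2 + 2 * D + B) * t.weight β := by
  have := isProbabilityMeasure_expMeasure hlam
  have := isProbabilityMeasure_ramStep T hlam
  have hexp : ∫⁻ y, (1 + ENNReal.ofReal (β' 1 * y)) ∂expMeasure (lam i) ≤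
      ENNReal.ofReal (1 + D) := by
    rw [lintegral_add_left measurable_const, lintegral_const, measure_univ, mul_one,
      ENNReal.ofReal_add zero_le_one hD, ENNReal.ofReal_one]
    gcongr
    simp_rw [ENNReal.ofReal_mul (hβ' 1)]
    rw [lintegral_const_mul _ ENNReal.measurable_ofReal, lintegral_ofReal_expMeasure hlam,
      ← ENNReal.ofReal_mul (hβ' 1)]
    refine ENNReal.ofReal_le_ofReal ?_
    rw [mul_one_div]
    exact div_le_of_le_mul₀ hlam.le hD hβD
  have hattach : ∀ (c : ℕ) (len : ℝ) (a b : Basin), 1 ≤ c → 0 ≤ len →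
      (junction len a b).ord = c + 1 →
      ∫⁻ s, s.weight β' ∂poissonAttach (lam (c + i) * T c) (lam i) len a b ≤
        ENNReal.ofReal (2 + 2 * D + B) * ENNReal.ofReal (β c * len) +
          (a.weight β' + b.weight β') := by
    intro c len a b hc hlen hord
    refine (lintegral_poissonAttach_le hlam hlen (measurable_weight β')
      (g := fun y => 1 + ENNReal.ofReal (β' 1 * y)) (by fun_prop)
      fun s x y hs hx hxl hy => (hs.weight_insertStream hβ' hx hxl hy).le).trans ?_
    rw [weight, hord, add_right_comm]
    gcongr
    calc
      _ ≤ ENNReal.ofReal (B * (β c * len)) +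
          ENNReal.ofReal (β c * len) * ENNReal.ofReal (1 + D) := by
        refine add_le_add (ENNReal.ofReal_le_ofReal ?_)
          (mul_le_mul' (ENNReal.ofReal_le_ofReal ?_) hexp)
        · rw [← mul_assoc]
          exact mul_le_mul_of_nonneg_right (hββ' c hc) hlen
        · exact mul_le_mul_of_nonneg_right (hT c hc) hlen
      _ = ENNReal.ofReal ((1 + D + B) * (β c * len)) := by
        have := mul_nonneg (hβ c) hlen
        rw [← ENNReal.ofReal_mul this, ← ENNReal.ofReal_add (by positivity) (by positivity)]
        congr 1
        ring
      _ ≤ _ := by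
        have := mul_nonneg (hβ c) hlen
        rw [← ENNReal.ofReal_mul (by positivity)]
        exact ENNReal.ofReal_le_ofReal (mul_le_mul_of_nonneg_right (by linarith) this)
  induction t with
  | source len =>
    have hlen := nonNeg_source.1 ht
    rw [lintegral_ramStep_source T hlam _ (measurable_weight β')]
    calc
      _ ≤ ∫⁻ y₁, ∫⁻ y₂, (ENNReal.ofReal (2 + 2 * D + B) * ENNReal.ofReal (β 1 * len) +
            ((1 + ENNReal.ofReal (β' 1 * y₁)) + (1 + ENNReal.ofReal (β' 1 * y₂))))
            ∂expMeasure (lam i) ∂expMeasure (lam i) := by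
        gcongr with y₁ y₂
        exact hattach 1 len _ _ le_rfl hlen rfl
      _ ≤ ENNReal.ofReal (2 + 2 * D + B) * ENNReal.ofReal (β 1 * len) +
            (ENNReal.ofReal (1 + D) + ENNReal.ofReal (1 + D)) := by
        rw [lintegral_lintegral_const_add_add]
        gcongr
      _ ≤ _ := by
        rw [weight, mul_add, mul_one, add_comm, ← ENNReal.ofReal_add (by positivity) (by positivity)]
        exact add_le_add_left (ENNReal.ofReal_le_ofReal (by linarith)) _
  | junction len a b iha ihb =>
    obtain ⟨hlen, ha, hb⟩ := nonNeg_junction.1 ht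
    rw [lintegral_ramStep_junction T hlam _ _ _ (measurable_weight β')]
    calc
      _ ≤ ∫⁻ a', ∫⁻ b', (ENNReal.ofReal (2 + 2 * D + B) *
            ENNReal.ofReal (β (junction len a b).ord * len) + (a'.weight β' + b'.weight β'))
            ∂ramStep T lam i b ∂ramStep T lam i a := by
        refine lintegral_mono_ae ?_
        filter_upwards [ae_ramStep T hlam ha] with a' ha'
        refine lintegral_mono_ae ?_
        filter_upwards [ae_ramStep T hlam hb] with b' hb'
        refine hattach _ len _ _ (one_le_ord _) hlen ?_
        rw [ord, ord, ha'.2.1, hb'.2.1]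
        split_ifs <;> omega
      _ ≤ _ := by
        rw [lintegral_lintegral_const_add_add, weight, mul_add,
          mul_add]
        exact add_le_add_right (add_le_add (iha ha) (ihb hb)) _

/-- A union bound: the height exceeds `t.height + h₀` by at most the sum of the excesses over `h₀`
of the new streams, since each is attached at a point no farther from the outlet than `t.height`.
The factor `2` accounts for the two streams at each source. -/
theorem lintegral_height_sub_ramStep_le {T lam β : ℕ → ℝ} {i : ℕ} {h₀ : ℝ} (hlam : 0 < lam i)
    (hT : ∀ c, 1 ≤ c → lam (c + i) * T c ≤ β c) {t : Basin} (ht : t.NonNeg) :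
    ∫⁻ s, ENNReal.ofReal (s.height - (t.height + h₀)) ∂ramStep T lam i t ≤
      2 * t.weight β * ∫⁻ y, ENNReal.ofReal (y - h₀) ∂expMeasure (lam i) := by
  have := isProbabilityMeasure_expMeasure hlam
  have := isProbabilityMeasure_ramStep T hlam
  set E := ∫⁻ y, ENNReal.ofReal (y - h₀) ∂expMeasure (lam i) with hE
  have hattach : ∀ (c : ℕ) (len h : ℝ) (a b : Basin), 1 ≤ c → 0 ≤ len → len ≤ h →
      ∫⁻ s, ENNReal.ofReal (s.height - (h + h₀))
          ∂poissonAttach (lam (c + i) * T c) (lam i) len a b ≤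
        2 * ENNReal.ofReal (β c * len) * E +
          ENNReal.ofReal ((junction len a b).height - (h + h₀)) := by
    intro c len h a b hc hlen hh
    refine (lintegral_poissonAttach_le hlam hlen (by fun_prop)
      (g := fun y => ENNReal.ofReal (y - h₀)) (by fun_prop) fun s x y hs hx hxl hy => ?_).trans ?_
    · rw [height_insertStream]
      rcases max_cases s.height (x + y) with ⟨h1, -⟩ | ⟨h1, -⟩ <;> rw [h1]
      · exact le_self_add
      · exact le_add_left (ENNReal.ofReal_le_ofReal (by linarith))
    · rw [add_comm]
      gcongr
      refine (ENNReal.ofReal_le_ofReal (mul_le_mul_of_nonneg_right (hT c hc) hlen)).trans ?_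
      rw [two_mul]
      exact le_self_add
  induction t with
  | source len =>
    have hlen := nonNeg_source.1 ht
    rw [lintegral_ramStep_source T hlam _ (by fun_prop)]
    calc
      _ ≤ ∫⁻ y₁, ∫⁻ y₂, (2 * ENNReal.ofReal (β 1 * len) * E +
            (ENNReal.ofReal (y₁ - h₀) + ENNReal.ofReal (y₂ - h₀)))
            ∂expMeasure (lam i) ∂expMeasure (lam i) := by
        refine lintegral_mono fun y₁ => lintegral_mono fun y₂ => ?_
        refine (hattach 1 len _ _ _ le_rfl hlen le_rfl).trans (add_le_add_right ?_ _)
        simp only [height]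
        rcases max_cases y₁ y₂ with ⟨h1, -⟩ | ⟨h1, -⟩ <;> rw [h1]
        · exact le_add_right (ENNReal.ofReal_le_ofReal (by linarith))
        · exact le_add_left (ENNReal.ofReal_le_ofReal (by linarith))
      _ = _ := by
        rw [lintegral_lintegral_const_add_add, ← hE, weight]
        ring
  | junction len a b iha ihb =>
    obtain ⟨hlen, ha, hb⟩ := nonNeg_junction.1 ht
    have hha := ha.height_nonneg
    rw [lintegral_ramStep_junction T hlam _ _ _ (by fun_prop)]
    calc
      _ ≤ ∫⁻ a', ∫⁻ b', (2 * ENNReal.ofReal (β (junction len a b).ord * len) * E +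
            (ENNReal.ofReal (a'.height - (a.height + h₀)) +
              ENNReal.ofReal (b'.height - (b.height + h₀))))
            ∂ramStep T lam i b ∂ramStep T lam i a := by
        refine lintegral_mono fun a' => lintegral_mono fun b' => ?_
        have hle : len ≤ (junction len a b).height := by
          simp only [height]
          linarith [le_max_left a.height b.height]
        refine (hattach _ len _ _ _ (one_le_ord _) hlen hle).trans (add_le_add_right ?_ _)
        simp only [height]
        have h2 := le_max_left a.height b.height
        have h3 := le_max_right a.height b.height
        rcases max_cases a'.height b'.height with ⟨h1, -⟩ | ⟨h1, -⟩ <;> rw [h1]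
        · exact le_add_right (ENNReal.ofReal_le_ofReal (by linarith))
        · exact le_add_left (ENNReal.ofReal_le_ofReal (by linarith))
      _ ≤ 2 * ENNReal.ofReal (β (junction len a b).ord * len) * E +
            (2 * a.weight β * E + 2 * b.weight β * E) := by
        rw [lintegral_lintegral_const_add_add]
        exact add_le_add_right (add_le_add (iha ha) (ihb hb)) _
      _ = _ := by
        rw [weight]
        ring

theorem lintegral_height_ramStep_le {T lam β : ℕ → ℝ} {i : ℕ} {h₀ : ℝ} (hlam : 0 < lam i)
    (hT : ∀ c, 1 ≤ c → lam (c + i) * T c ≤ β c) {t : Basin} (ht : t.NonNeg) :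
    ∫⁻ s, ENNReal.ofReal s.height ∂ramStep T lam i t ≤
      ENNReal.ofReal t.height + ENNReal.ofReal h₀ +
        2 * t.weight β * ∫⁻ y, ENNReal.ofReal (y - h₀) ∂expMeasure (lam i) := by
  have := isProbabilityMeasure_ramStep T hlam
  calc
    _ ≤ ∫⁻ s, (ENNReal.ofReal t.height + ENNReal.ofReal h₀ +
          ENNReal.ofReal (s.height - (t.height + h₀))) ∂ramStep T lam i t := by
      refine lintegral_mono fun s => ?_
      calc
        ENNReal.ofReal s.height =
            ENNReal.ofReal (t.height + h₀ + (s.height - (t.height + h₀))) := by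
          congr 1
          ring
        _ ≤ _ := ENNReal.ofReal_add_le.trans (add_le_add_left ENNReal.ofReal_add_le _)
    _ ≤ _ := by
      rw [lintegral_add_left measurable_const, lintegral_const, measure_univ, mul_one]
      exact add_le_add_right (lintegral_height_sub_ramStep_le hlam hT ht) _

/-! ### Scaling of lengths -/

namespace Basin

/-- Multiply all link lengths by `c`. -/
def scale (c : ℝ) : Basin → Basin
  | source len => source (c * len)
  | junction len a b => junction (c * len) (a.scale c) (b.scale c)

theorem shape_scale (c : ℝ) (t : Basin) : (t.scale c).shape = t.shape := by
  induction t with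
  | source => rfl
  | junction len a b iha ihb => rw [scale, shape, shape, iha, ihb]

theorem linkLength_scale (c : ℝ) (t : Basin) (w : List Bool) :
    (t.scale c).linkLength w = c * t.linkLength w := by
  induction t generalizing w with
  | source => cases w <;> simp [scale, linkLength]
  | junction len a b iha ihb =>
    match w with
    | [] => rfl
    | false :: w => exact iha w
    | true :: w => exact ihb w

@[fun_prop]
theorem measurable_scale (c : ℝ) : Measurable (scale c) :=
  measurable_of_shape_linkLength (by simp only [shape_scale]; fun_prop) fun w => by
    simp only [linkLength_scale]
    fun_prop

theorem ord_scale (c : ℝ) (t : Basin) : (t.scale c).ord = t.ord := by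
  rw [← ord_shape, shape_scale, ord_shape]

theorem height_scale {c : ℝ} (hc : 0 ≤ c) (t : Basin) : (t.scale c).height = c * t.height := by
  induction t with
  | source => rfl
  | junction len a b iha ihb =>
    rw [scale, height, height, iha, ihb, mul_add, mul_max_of_nonneg _ _ hc]

theorem scale_insertStream {c : ℝ} (hc : 0 < c) (x y : ℝ) (t : Basin) :
    (t.insertStream x y).scale c = (t.scale c).insertStream (c * x) (c * y) := by
  induction t generalizing x with
  | source => simp [insertStream, scale, mul_sub]
  | junction len a b iha ihb =>
    simp only [insertStream, scale, mul_lt_mul_iff_right₀ hc]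
    split_ifs
    · simp [scale, mul_sub]
    · simp [scale, ihb, mul_sub]

theorem scale_insertStreams {c : ℝ} (hc : 0 < c) (len : ℝ) (l : List (ℝ × ℝ)) (t : Basin) :
    (insertStreams len l t).scale c =
      insertStreams (c * len) (l.map fun p => (p.1, c * p.2)) (t.scale c) := by
  induction l generalizing t with
  | nil => rfl
  | cons p l ih =>
    change (insertStreams len l (t.insertStream (len * p.1) p.2)).scale c =
      insertStreams (c * len) (l.map fun p => (p.1, c * p.2))
        ((t.scale c).insertStream (c * len * p.1) (c * p.2))
    rw [ih, scale_insertStream hc, mul_assoc]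

end Basin

theorem map_mul_left_expMeasure {r c : ℝ} (hc : 0 < c) :
    (expMeasure r).map (c * ·) = expMeasure (r / c) := by
  ext S hS
  have hf : Measurable (S.indicator (1 : ℝ → ℝ≥0∞)) := measurable_one.indicator hS
  rw [← lintegral_indicator_one hS, ← lintegral_indicator_one hS, lintegral_map hf (by fun_prop),
    lintegral_expMeasure _ (f := fun y => S.indicator 1 (c * y)) (by fun_prop),
    lintegral_expMeasure _ hf]
  have hpdf : ∀ y, exponentialPDF r y =
      ENNReal.ofReal c * exponentialPDF (r / c) (c * y) := by
    intro y
    rw [exponentialPDF_eq, exponentialPDF_eq, ← ENNReal.ofReal_mul hc.le]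
    congr 1
    simp only [mul_nonneg_iff_of_pos_left hc]
    split_ifs
    · field_simp
    · simp
  simp_rw [hpdf, mul_assoc]
  rw [lintegral_const_mul' _ _ ENNReal.ofReal_ne_top,
    ← lintegral_map (f := fun z => exponentialPDF (r / c) z * S.indicator 1 z)
      ((measurable_exponentialPDF _).mul hf) (measurable_const_mul c),
    Real.map_volume_mul_left hc.ne', lintegral_smul_measure, smul_eq_mul, ← mul_assoc,
    ← ENNReal.ofReal_mul hc.le, abs_of_pos (inv_pos.2 hc), mul_inv_cancel₀ hc.ne']
  simp

theorem map_attachLaw {r c : ℝ} (hr : 0 < r) (hc : 0 < c) :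
    (attachLaw r).map (fun p => (p.1, c * p.2)) = attachLaw (r / c) := by
  have := isProbabilityMeasure_expMeasure hr
  have h := Measure.map_prod_map ((volume : Measure ℝ).restrict (Set.Icc 0 1)) (expMeasure r)
    measurable_id (measurable_const_mul c)
  rw [Measure.map_id, map_mul_left_expMeasure hc] at h
  exact h.symm

/-- Dividing the intensity by `c` and multiplying the link by `c` leaves the Poisson mean and the
relative positions unchanged; only the stream lengths rescale. -/
theorem lintegral_scale_poissonAttach {ι r c : ℝ} (hr : 0 < r) (hc : 0 < c) (len : ℝ)
    (a b : Basin) {f : Basin → ℝ≥0∞} (hf : Measurable f) :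
    ∫⁻ s, f (s.scale c) ∂poissonAttach ι r len a b =
      ∫⁻ s, f s ∂poissonAttach (ι / c) (r / c) (c * len) (a.scale c) (b.scale c) := by
  have := isProbabilityMeasure_attachLaw hr
  have := isProbabilityMeasure_attachLaw (div_pos hr hc)
  rw [lintegral_poissonAttach _ _ _ _ _ (f := fun s => f (s.scale c)) (by fun_prop),
    lintegral_poissonAttach _ _ _ _ _ hf,
    show ι / c * (c * len) = ι * len by field_simp]
  congr with n
  have hpi : (Measure.pi fun _ : Fin n => attachLaw (r / c)) =
      (Measure.pi fun _ : Fin n => attachLaw r).map fun q i => ((q i).1, c * (q i).2) := by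
    rw [← map_attachLaw hr hc]
    exact (Measure.pi_map_pi (μ := fun _ : Fin n => attachLaw r)
      (f := fun _ p => (p.1, c * p.2)) (fun _ => by fun_prop)).symm
  rw [hpi, lintegral_map (f := fun q => f (insertStreams _ (List.ofFn q) _))
    (hf.comp (measurable_insertStreams_right n _ _)) (by fun_prop)]
  congr with q
  rw [scale_insertStreams hc, List.map_ofFn]
  rfl

theorem lintegral_scale_expMeasure {r c : ℝ} (hc : 0 < c) {f : ℝ → ℝ≥0∞} (hf : Measurable f) :
    ∫⁻ y, f (c * y) ∂expMeasure r = ∫⁻ y, f y ∂expMeasure (r / c) := by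
  rw [← map_mul_left_expMeasure hc, lintegral_map hf (by fun_prop)]

theorem lintegral_scale_ramStep (T : ℕ → ℝ) {lam : ℕ → ℝ} {c : ℝ} (hlam : ∀ i, 0 < lam i)
    (hc : 0 < c) (hlam' : ∀ i, lam (i + 1) = lam i / c) (i : ℕ) (t : Basin)
    {f : Basin → ℝ≥0∞} (hf : Measurable f) :
    ∫⁻ s, f (s.scale c) ∂ramStep T lam i t = ∫⁻ s, f s ∂ramStep T lam (i + 1) (t.scale c) := by
  have hdiv : ∀ k, lam (k + (i + 1)) * T k = lam (k + i) * T k / c := fun k => by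
    rw [← add_assoc, hlam']
    ring
  induction t generalizing f with
  | source len =>
    have := isProbabilityMeasure_expMeasure (hlam i)
    have := isProbabilityMeasure_expMeasure (hlam (i + 1))
    obtain ⟨F, hF⟩ : ∃ F : ℝ × ℝ → ℝ≥0∞, ∀ y₁ y₂, F (y₁, y₂) = ∫⁻ s, f s
        ∂poissonAttach (lam (1 + (i + 1)) * T 1) (lam (i + 1)) (c * len) (.source y₁) (.source y₂) :=
      ⟨fun p => ∫⁻ s, f s ∂poissonAttach (lam (1 + (i + 1)) * T 1) (lam (i + 1)) (c * len)
        (.source p.1) (.source p.2), fun _ _ => rfl⟩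
    have hm : Measurable F := by
      have : Measurable fun p : ℝ × ℝ => poissonAttach (lam (1 + (i + 1)) * T 1)
          (lam (i + 1)) (c * len) (.source p.1) (.source p.2) :=
        .poissonAttach _ (hlam (i + 1)) (by fun_prop) (by fun_prop) (by fun_prop)
      have h := (Measure.measurable_lintegral hf).comp this
      simp only [Function.comp_def, ← hF] at h
      exact h
    have hexp : ∀ g : ℝ → ℝ≥0∞, Measurable g → ∫⁻ y, g (c * y) ∂expMeasure (lam i) =
        ∫⁻ y, g y ∂expMeasure (lam (i + 1)) := fun g hg => by
      rw [hlam', lintegral_scale_expMeasure hc hg]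
    have hF' : ∀ y₁ y₂, ∫⁻ s, f (s.scale c)
        ∂poissonAttach (lam (1 + i) * T 1) (lam i) len (.source y₁) (.source y₂) =
          F (c * y₁, c * y₂) := fun y₁ y₂ => by
      rw [hF, lintegral_scale_poissonAttach (hlam i) hc _ _ _ hf, hdiv, hlam' i, scale, scale]
    rw [scale, lintegral_ramStep_source T (hlam i) _ (f := fun s => f (s.scale c)) (by fun_prop),
      lintegral_ramStep_source T (hlam (i + 1)) _ hf]
    simp_rw [hF', ← hF]
    rw [← hexp (fun y₁ => ∫⁻ y₂, F (y₁, y₂) ∂expMeasure (lam (i + 1))) hm.lintegral_prod_right']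
    congr with y₁
    exact hexp (fun y₂ => F (c * y₁, y₂)) (by fun_prop)
  | junction len a b iha ihb =>
    have := isProbabilityMeasure_ramStep T (hlam i)
    have := isProbabilityMeasure_ramStep T (hlam (i + 1))
    have hord := ord_scale c (.junction len a b)
    rw [scale] at hord
    obtain ⟨k, hk⟩ : ∃ k, (Basin.junction len a b).ord = k := ⟨_, rfl⟩
    obtain ⟨F, hF⟩ : ∃ F : Basin × Basin → ℝ≥0∞, ∀ a' b', F (a', b') = ∫⁻ s, f s
        ∂poissonAttach (lam (k + (i + 1)) * T k) (lam (i + 1)) (c * len) a' b' :=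
      ⟨fun p => ∫⁻ s, f s ∂poissonAttach (lam (k + (i + 1)) * T k) (lam (i + 1)) (c * len)
        p.1 p.2, fun _ _ => rfl⟩
    have hm : Measurable F := by
      have : Measurable fun p : Basin × Basin => poissonAttach (lam (k + (i + 1)) * T k)
          (lam (i + 1)) (c * len) p.1 p.2 :=
        .poissonAttach _ (hlam (i + 1)) (by fun_prop) (by fun_prop) (by fun_prop)
      have h := (Measure.measurable_lintegral hf).comp this
      simp only [Function.comp_def, ← hF] at h
      exact h
    have hF' : ∀ a' b', ∫⁻ s, f (s.scale c)
        ∂poissonAttach (lam (k + i) * T k) (lam i) len a' b' =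
          F (a'.scale c, b'.scale c) := fun a' b' => by
      rw [hF, lintegral_scale_poissonAttach (hlam i) hc _ _ _ hf, hdiv, hlam' i]
    rw [scale, lintegral_ramStep_junction T (hlam i) _ _ _ (f := fun s => f (s.scale c))
      (by fun_prop), lintegral_ramStep_junction T (hlam (i + 1)) _ _ _ hf, hord, hk]
    simp_rw [hF', ← hF]
    rw [← iha (f := fun a' => ∫⁻ b', F (a', b') ∂ramStep T lam (i + 1) (b.scale c))
      hm.lintegral_prod_right']
    congr with a'
    exact ihb (f := fun b' => F (a'.scale c, b')) (by fun_prop)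

theorem lintegral_scale_ramStage (T : ℕ → ℝ) {lam : ℕ → ℝ} {c : ℝ} (hlam : ∀ i, 0 < lam i)
    (hc : 0 < c) (hlam' : ∀ i, lam (i + 1) = lam i / c) (n i : ℕ)
    {f : Basin → ℝ≥0∞} (hf : Measurable f) :
    ∫⁻ s, f (s.scale c) ∂ramStage T lam n i = ∫⁻ s, f s ∂ramStage T lam n (i + 1) := by
  induction n generalizing i f with
  | zero =>
    rw [ramStage, ramStage, lintegral_map (f := fun s => f (s.scale c)) (by fun_prop) measurable_source,
      lintegral_map hf measurable_source, hlam',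
      ← lintegral_scale_expMeasure hc (f := fun y => f (source y)) (by fun_prop)]
    rfl
  | succ n ih =>
    rw [lintegral_ramStage_succ T n (hlam i) (f := fun s => f (s.scale c)) (by fun_prop),
      lintegral_ramStage_succ T n (hlam (i + 1)) hf,
      ← ih (i + 1) (f := fun t => ∫⁻ s, f s ∂ramStep T lam (i + 1) t)
        ((Measure.measurable_lintegral hf).comp (measurable_ramStep T (hlam (i + 1))))]
    simp_rw [lintegral_scale_ramStep T hlam hc hlam' i _ hf]

/-! ### Order and mean weight of a stage -/

theorem ae_ramStage (T : ℕ → ℝ) {lam : ℕ → ℝ} (hlam : ∀ i, 0 < lam i) (n i : ℕ) :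
    ∀ᵐ t ∂ramStage T lam n i, t.NonNeg ∧ t.ord = n + 1 := by
  have hmeas (n : ℕ) : MeasurableSet {t : Basin | t.NonNeg ∧ t.ord = n + 1} :=
    measurableSet_nonNeg.inter (measurable_ord (MeasurableSet.singleton (n + 1)))
  induction n generalizing i with
  | zero =>
    rw [ramStage, ae_map_iff measurable_source.aemeasurable (hmeas 0)]
    filter_upwards [ae_nonneg_expMeasure (lam i)] with y hy using ⟨nonNeg_source.2 hy, rfl⟩
  | succ n ih =>
    have hbind : ∀ᵐ t ∂ramStage T lam n (i + 1), ∀ᵐ s ∂ramStep T lam i t,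
        s.NonNeg ∧ s.ord = n + 1 + 1 := by
      filter_upwards [ih (i + 1)] with t ht
      filter_upwards [ae_ramStep T (hlam i) ht.1] with s hs
      exact ⟨hs.1, by rw [hs.2.1, ht.2]⟩
    rw [ae_iff, ← Set.compl_ofPred, ramStage, Measure.bind_apply (hmeas (n + 1)).compl
      (measurable_ramStep T (hlam i)).aemeasurable,
      ← lintegral_zero (μ := ramStage T lam n (i + 1))]
    refine lintegral_congr_ae ?_
    filter_upwards [hbind] with t ht using ae_iff.1 ht

/-- After stage `i + 1` a link of current order `c` has final order `c + i`, so this weight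
dominates the intensities of step `i`. The geometric form of `w` makes the growth factor independent
of `i`. -/
theorem lintegral_weight_ramStage_le {T lam w : ℕ → ℝ} {B : ℝ} (hlam : ∀ i, 0 < lam i)
    (hw : ∀ c, 0 ≤ w c) (hB : 0 ≤ B) (hT : ∀ c, 1 ≤ c → T c ≤ w c)
    (hwB : ∀ c, w (c + 1) = B * w c) (n i : ℕ) :
    ∫⁻ t, t.weight (fun c => lam (c + i) * w c) ∂ramStage T lam n (i + 1) ≤
      ENNReal.ofReal (2 + 2 * w 1 + B) ^ n * ENNReal.ofReal (1 + w 1) := by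
  induction n generalizing i with
  | zero =>
    have := isProbabilityMeasure_expMeasure (hlam (i + 1))
    have h1 : 0 ≤ lam (1 + i) * w 1 := mul_nonneg (hlam _).le (hw 1)
    rw [ramStage, lintegral_map (measurable_weight _) measurable_source]
    simp only [weight, ENNReal.ofReal_mul h1]
    rw [lintegral_add_left measurable_const, lintegral_const, measure_univ, mul_one,
      lintegral_const_mul _ ENNReal.measurable_ofReal, lintegral_ofReal_expMeasure (hlam _),
      ← ENNReal.ofReal_mul h1, pow_zero, one_mul, ENNReal.ofReal_add zero_le_one (hw 1),
      ENNReal.ofReal_one, add_comm 1 i]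
    have := (hlam (i + 1)).ne'
    gcongr
    field_simp
    rfl
  | succ n ih =>
    rw [lintegral_ramStage_succ T n (hlam _) (measurable_weight _)]
    calc
      _ ≤ ∫⁻ t, ENNReal.ofReal (2 + 2 * w 1 + B) * t.weight (fun c => lam (c + (i + 1)) * w c)
          ∂ramStage T lam n (i + 1 + 1) := by
        refine lintegral_mono_ae ?_
        filter_upwards [ae_ramStage T hlam n (i + 1 + 1)] with t ht
        refine lintegral_weight_ramStep_le (hlam _) (fun c => mul_nonneg (hlam _).le (hw c))
          (fun c => mul_nonneg (hlam _).le (hw c)) hB (hw 1) (fun c hc => ?_) (fun c hc => ?_) ?_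
          ht.1
        · exact mul_le_mul_of_nonneg_left (hT c hc) (hlam _).le
        · rw [hwB, show c + 1 + i = c + (i + 1) by ring]
          exact (mul_left_comm _ _ _).le
        · rw [add_comm 1 i, mul_comm]
      _ ≤ _ := by
        rw [lintegral_const_mul _ (measurable_weight _), pow_succ', mul_assoc]
        gcongr
        exact ih (i + 1)

/-- The mean height of a basin of order `n + 1`. -/
noncomputable def stageHeight (T lam : ℕ → ℝ) (n : ℕ) : ℝ≥0∞ :=
  ∫⁻ t, ENNReal.ofReal t.height ∂ramStage T lam n 1

/-! ### The two-sided recursion for the mean height -/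

section

variable {T lam : ℕ → ℝ} {c : ℝ}

theorem lintegral_height_ramStage_two (hlam : ∀ i, 0 < lam i) (hc : 0 < c)
    (hlam' : ∀ i, lam (i + 1) = lam i / c) (n : ℕ) :
    ∫⁻ t, ENNReal.ofReal t.height ∂ramStage T lam n 2 = ENNReal.ofReal c * stageHeight T lam n := by
  rw [← lintegral_scale_ramStage T hlam hc hlam' n 1 (f := fun t => ENNReal.ofReal t.height)
    (by fun_prop), stageHeight, ← lintegral_const_mul _ (by fun_prop)]
  congr with t
  rw [height_scale hc.le, ENNReal.ofReal_mul hc.le]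

theorem stageHeight_zero (hlam : ∀ i, 0 < lam i) :
    stageHeight T lam 0 = ENNReal.ofReal (1 / lam 1) := by
  rw [stageHeight, ramStage, lintegral_map (by fun_prop) measurable_source]
  exact lintegral_ofReal_expMeasure (hlam 1)

theorem le_stageHeight_succ (hlam : ∀ i, 0 < lam i) (hc : 0 < c)
    (hlam' : ∀ i, lam (i + 1) = lam i / c) (n : ℕ) :
    ENNReal.ofReal c * stageHeight T lam n ≤ stageHeight T lam (n + 1) := by
  have := isProbabilityMeasure_ramStep T (hlam 1)
  rw [← lintegral_height_ramStage_two hlam hc hlam', stageHeight,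
    lintegral_ramStage_succ T n (hlam 1) (by fun_prop)]
  refine lintegral_mono_ae ?_
  filter_upwards [ae_ramStage T hlam n 2] with t ht
  calc
    _ = ∫⁻ s, ENNReal.ofReal t.height ∂ramStep T lam 1 t := by simp
    _ ≤ _ := by
      refine lintegral_mono_ae ?_
      filter_upwards [ae_ramStep T (hlam 1) ht.1] with s hs using ENNReal.ofReal_le_ofReal hs.2.2

/-- A level linear in `n` suffices against exponentially many new streams, because their lengths
have exponential tails with the fixed rate `lam 1`. -/
theorem stageHeight_succ_le {w : ℕ → ℝ} {B : ℝ} (hlam : ∀ i, 0 < lam i) (hc : 0 < c)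
    (hlam' : ∀ i, lam (i + 1) = lam i / c) (hw : ∀ c, 0 ≤ w c) (hB : 0 ≤ B)
    (hT : ∀ c, 1 ≤ c → T c ≤ w c) (hwB : ∀ c, w (c + 1) = B * w c) (n : ℕ) :
    stageHeight T lam (n + 1) ≤ ENNReal.ofReal c * stageHeight T lam n +
      (ENNReal.ofReal (n * (Real.log (2 + 2 * w 1 + B) / lam 1) + 2 * (1 + w 1) / lam 1)) := by
  have := isProbabilityMeasure_ramStage T hlam n 2
  have hw1 := hw 1
  have hl1 := hlam 1
  set R := 2 + 2 * w 1 + B with hR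
  have hR1 : 1 ≤ R := by linarith
  have hlog : 0 ≤ Real.log R := Real.log_nonneg hR1
  -- Chosen so that `exp (-(lam 1 * a))` is exactly `(R ^ n)⁻¹`, which cancels the bound on the mean
  -- weight.
  set a := n * (Real.log R / lam 1) with ha
  have ha0 : 0 ≤ a := by positivity
  have hexp : Real.exp (-(lam 1 * a)) = (R ^ n)⁻¹ := by
    rw [ha, show lam 1 * (n * (Real.log R / lam 1)) = n * Real.log R by field_simp, Real.exp_neg,
      Real.exp_nat_mul, Real.exp_log (by linarith)]
  have hmw : Measurable fun t : Basin => t.weight fun c => lam (c + 1) * w c := by fun_prop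
  calc
    _ ≤ ∫⁻ t, (ENNReal.ofReal t.height + ENNReal.ofReal a +
          2 * t.weight (fun c => lam (c + 1) * w c) *
            ∫⁻ y, ENNReal.ofReal (y - a) ∂expMeasure (lam 1)) ∂ramStage T lam n 2 := by
      rw [stageHeight, lintegral_ramStage_succ T n (hlam 1) (by fun_prop)]
      refine lintegral_mono_ae ?_
      filter_upwards [ae_ramStage T hlam n 2] with t ht
      exact lintegral_height_ramStep_le (hlam 1)
        (fun c hc => mul_le_mul_of_nonneg_left (hT c hc) (hlam _).le) ht.1
    _ = ENNReal.ofReal c * stageHeight T lam n + (ENNReal.ofReal a +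
          2 * (∫⁻ t, t.weight (fun c => lam (c + 1) * w c) ∂ramStage T lam n 2) *
            (ENNReal.ofReal (R ^ n)⁻¹ * ENNReal.ofReal (1 / lam 1))) := by
      rw [lintegral_add_left (by fun_prop), lintegral_add_left (by fun_prop), lintegral_const,
        measure_univ, mul_one, lintegral_height_ramStage_two hlam hc hlam',
        lintegral_ofReal_sub_expMeasure hl1 ha0, hexp, add_assoc,
        lintegral_mul_const _ (by fun_prop), lintegral_const_mul _ hmw]
    _ ≤ ENNReal.ofReal c * stageHeight T lam n + (ENNReal.ofReal a +
          ENNReal.ofReal 2 * (ENNReal.ofReal R ^ n * ENNReal.ofReal (1 + w 1)) *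
            (ENNReal.ofReal (R ^ n)⁻¹ * ENNReal.ofReal (1 / lam 1))) := by
      rw [ENNReal.ofReal_ofNat]
      gcongr
      exact lintegral_weight_ramStage_le hlam hw hB hT hwB n 1
    _ = _ := by
      rw [← ENNReal.ofReal_pow (by positivity), ← ENNReal.ofReal_mul (by positivity),
        ← ENNReal.ofReal_mul (by positivity), ← ENNReal.ofReal_mul (by positivity),
        ← ENNReal.ofReal_mul (by positivity), ← ENNReal.ofReal_add (by positivity) (by positivity)]
      congr 3
      have : R ^ n ≠ 0 := by positivity
      field_simp

end

/-! ### Convergence, tameness and conditioning on the order -/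

theorem exists_tendsto_mul_inv_pow {H : ℕ → ℝ} {ζ c K : ℝ} (hζ : 1 < ζ) (h0 : 0 < H 0)
    (hc : 0 ≤ c) (hK : 0 ≤ K)
    (hlow : ∀ n, ζ * H n ≤ H (n + 1)) (hupp : ∀ n : ℕ, H (n + 1) ≤ ζ * H n + (n * c + K)) :
    ∃ C, 0 < C ∧ Tendsto (fun n => H n * ζ⁻¹ ^ n) atTop (𝓝 C) := by
  have hζ0 : 0 < ζ := by linarith
  have hstep : ∀ n x, ζ * x * ζ⁻¹ ^ (n + 1) = x * ζ⁻¹ ^ n := fun n x => by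
    rw [pow_succ]
    field_simp
  have hmono : Monotone fun n => H n * ζ⁻¹ ^ n := monotone_nat_of_le_succ fun n => by
    rw [← hstep]
    exact mul_le_mul_of_nonneg_right (hlow n) (by positivity)
  -- The bound on the increment of `H n * ζ⁻¹ ^ n`: linear times geometric, hence summable.
  set d : ℕ → ℝ := fun n => (n * c + K) * ζ⁻¹ ^ (n + 1) with hd
  have hρ : ‖ζ⁻¹‖ < 1 := by
    rw [Real.norm_of_nonneg (by positivity)]
    exact inv_lt_one_of_one_lt₀ hζ
  have hsum : Summable d := by
    have h1 := (summable_pow_mul_geometric_of_norm_lt_one 1 hρ).mul_left (c * ζ⁻¹)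
    have h2 := (summable_geometric_of_norm_lt_one hρ).mul_left (K * ζ⁻¹)
    exact (h1.add h2).congr fun n => by
      rw [hd]
      ring
  have hbound : ∀ n, H n * ζ⁻¹ ^ n ≤ H 0 + ∑ k ∈ Finset.range n, d k := by
    intro n
    induction n with
    | zero => simp
    | succ n ih =>
      rw [Finset.sum_range_succ, ← add_assoc]
      refine le_trans ?_ (add_le_add_left ih _)
      rw [← hstep n, ← add_mul]
      exact mul_le_mul_of_nonneg_right (hupp n) (by positivity)
  have hbdd : BddAbove (Set.range fun n => H n * ζ⁻¹ ^ n) := by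
    refine ⟨H 0 + ∑' k, d k, ?_⟩
    rintro _ ⟨n, rfl⟩
    refine (hbound n).trans (add_le_add_right (hsum.sum_le_tsum _ fun k _ => ?_) _)
    rw [hd]
    positivity
  refine ⟨_, lt_of_lt_of_le h0 ?_, tendsto_atTop_ciSup hmono hbdd⟩
  have := le_ciSup hbdd 0
  simpa using this

theorem exists_le_mul_pow_of_limsup_lt_top {T : ℕ → ℝ} (hT : ∀ k : ℕ, 1 ≤ k → 0 ≤ T k)
    (h : limsup (fun k : ℕ => ((T k ^ (1 / (k : ℝ)) : ℝ) : EReal)) atTop < ⊤) :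
    ∃ A B : ℝ, 0 ≤ A ∧ 0 ≤ B ∧ ∀ k, 1 ≤ k → T k ≤ A * B ^ k := by
  obtain ⟨b, hb, -⟩ := EReal.lt_iff_exists_real_btwn.1 h
  obtain ⟨N, hN⟩ := eventually_atTop.1 (eventually_lt_of_limsup_lt hb)
  -- With `B ≥ 1` all powers are at least `1`, so the finitely many terms before `N` can be absorbed
  -- into the constant `A`.
  set B := max b 1
  have hB : 1 ≤ B := le_max_right _ _
  have hB0 : 0 ≤ B := zero_le_one.trans hB
  have hpow : ∀ k, 1 ≤ B ^ k := fun k => one_le_pow₀ hB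
  refine ⟨1 + ∑ k ∈ Finset.range N, |T k|, B, by positivity, hB0, fun k hk => ?_⟩
  rcases lt_or_ge k N with hkN | hkN
  · have h1 : |T k| ≤ ∑ k ∈ Finset.range N, |T k| :=
      Finset.single_le_sum (f := fun k => |T k|) (fun _ _ => abs_nonneg _) (Finset.mem_range.2 hkN)
    have h2 := le_abs_self (T k)
    nlinarith [hpow k, abs_nonneg (T k)]
  · have h1 : T k ^ (1 / (k : ℝ)) ≤ B :=
      (EReal.coe_lt_coe_iff.1 (hN k hkN)).le.trans (le_max_left _ _)
    have h2 : T k ≤ B ^ k := by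
      have h3 := pow_le_pow_left₀ (Real.rpow_nonneg (hT k hk) _) h1 k
      rwa [one_div, Real.rpow_inv_natCast_pow (hT k hk) (by omega)] at h3
    have h4 : 0 ≤ ∑ k ∈ Finset.range N, |T k| := Finset.sum_nonneg fun _ _ => abs_nonneg _
    nlinarith [hpow k]

/-- Each stage lives almost surely on a single order, so the event selects one summand of the
mixture, and its positive weight cancels in the normalisation. -/
theorem cond_ord_ramLaw (T : ℕ → ℝ) {lam π : ℕ → ℝ} (hlam : ∀ i, 0 < lam i) {n : ℕ}
    (hπ : 0 < π (n + 1)) :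
    (ramLaw T lam π)[|{t : Basin | t.ord = n + 1}] = ramStage T lam n 1 := by
  have := isProbabilityMeasure_ramStage T hlam
  set S := {t : Basin | t.ord = n + 1} with hSdef
  have hS : MeasurableSet S := measurable_ord (MeasurableSet.singleton (n + 1))
  have hself : (ramStage T lam n 1).restrict S = ramStage T lam n 1 :=
    Measure.restrict_eq_self_of_ae_mem ((ae_ramStage T hlam n 1).mono fun t ht => ht.2)
  have hzero : ∀ m, m ≠ n → (ramStage T lam m 1).restrict S = 0 := fun m hm => by
    rw [Measure.restrict_eq_zero, ← compl_compl S]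
    refine mem_ae_iff.1 ?_
    filter_upwards [ae_ramStage T hlam m 1] with t ht h
    rw [hSdef, Set.mem_ofPred_eq, ht.2] at h
    omega
  have hrestr : (ramLaw T lam π).restrict S = ENNReal.ofReal (π (n + 1)) • ramStage T lam n 1 := by
    ext U hU
    rw [ramLaw, Measure.restrict_sum _ hS, Measure.sum_apply _ hU, tsum_eq_single n]
    · rw [Measure.restrict_smul, hself]
    · intro m hm
      rw [Measure.restrict_smul, hzero m hm]
      simp
  have hmeasure : ramLaw T lam π S = ENNReal.ofReal (π (n + 1)) := by
    rw [← Measure.restrict_apply_univ, hrestr]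
    simp
  rw [ProbabilityTheory.cond, hrestr, hmeasure, smul_smul, ENNReal.inv_mul_cancel (by simpa using hπ)
    ENNReal.ofReal_ne_top, one_smul]

theorem theorem4 (T : ℕ → ℝ) (hT : ∀ k : ℕ, 1 ≤ k → 0 ≤ T k)
    (hT_tame : limsup (fun k : ℕ => ((T k ^ (1 / (k : ℝ)) : ℝ) : EReal)) atTop < ⊤)
    (γ ζ p : ℝ) (hγ : 0 < γ) (hζ : 1 < ζ) (hp : 0 < p) (hp_lt : p < 1) :
    (∀ k : ℕ, 1 ≤ k →
      Integrable Basin.height ((selfSimilarRam T γ ζ p)[|{t : Basin | t.ord = k}])) ∧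
    ∃ C : ℝ, 0 < C ∧
      Tendsto (fun k : ℕ => meanHeight T γ ζ p k * ζ ^ (-(k : ℤ))) atTop (𝓝 C) := by
  have hζ0 : 0 < ζ := by linarith
  obtain ⟨lam, hlamdef⟩ : ∃ lam : ℕ → ℝ, lam = fun j : ℕ => γ * ζ ^ (1 - (j : ℤ)) := ⟨_, rfl⟩
  have hlam : ∀ i, 0 < lam i := fun i => by
    rw [hlamdef]
    positivity
  have hlam' : ∀ i, lam (i + 1) = lam i / ζ := fun i => by
    simp only [hlamdef]
    rw [mul_div_assoc, div_eq_mul_inv, ← zpow_sub_one₀ hζ0.ne']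
    congr 2
    push_cast
    ring
  obtain ⟨A, B, hA, hB, hAB⟩ := exists_le_mul_pow_of_limsup_lt_top hT hT_tame
  have hlow := le_stageHeight_succ (T := T) hlam hζ0 hlam'
  have hupp := stageHeight_succ_le (w := fun k => A * B ^ k) hlam hζ0 hlam'
    (fun k => by positivity) hB hAB (fun k => by ring)
  set R := 2 + 2 * (A * B ^ 1) + B
  set K := 2 * (1 + A * B ^ 1) / lam 1
  have hl1 := hlam 1
  have hR : 1 ≤ R := by
    have : 0 ≤ A * B ^ 1 := by positivity
    simp only [R]
    linarith
  have hK : 0 ≤ K := by positivity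
  have hc : 0 ≤ Real.log R / lam 1 := div_nonneg (Real.log_nonneg hR) hl1.le
  have hfin : ∀ n, stageHeight T lam n ≠ ∞ := fun n => by
    induction n with
    | zero =>
      rw [stageHeight_zero hlam]
      exact ENNReal.ofReal_ne_top
    | succ n ih =>
      exact ne_top_of_le_ne_top (ENNReal.add_ne_top.2
        ⟨ENNReal.mul_ne_top ENNReal.ofReal_ne_top ih, ENNReal.ofReal_ne_top⟩) (hupp n)
  have hcond : ∀ n : ℕ, (selfSimilarRam T γ ζ p)[|{t : Basin | t.ord = n + 1}] =
      ramStage T lam n 1 := fun n => by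
    rw [selfSimilarRam, ← hlamdef]
    refine cond_ord_ramLaw T hlam ?_
    have : 0 < 1 - p := by linarith
    positivity
  have hnonneg : ∀ n, 0 ≤ᵐ[ramStage T lam n 1] height := fun n =>
    (ae_ramStage T hlam n 1).mono fun t ht => ht.1.height_nonneg
  have hmean : ∀ n : ℕ, meanHeight T γ ζ p (n + 1) = (stageHeight T lam n).toReal := fun n => by
    rw [meanHeight, hcond, integral_eq_lintegral_of_nonneg_ae (hnonneg n)
      measurable_height.aestronglyMeasurable, stageHeight]
  constructor
  · intro k hk
    obtain ⟨n, rfl⟩ : ∃ n, k = n + 1 := ⟨k - 1, by omega⟩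
    rw [hcond]
    refine ⟨measurable_height.aestronglyMeasurable, ?_⟩
    rw [hasFiniteIntegral_iff_ofReal (hnonneg n)]
    exact (hfin n).lt_top
  · obtain ⟨C, hC, hlim⟩ := exists_tendsto_mul_inv_pow (H := fun n => (stageHeight T lam n).toReal)
      hζ (by
        rw [stageHeight_zero hlam, ENNReal.toReal_ofReal (by positivity)]
        positivity) hc hK
      (fun n => by
        have := ENNReal.toReal_mono (hfin (n + 1)) (hlow n)
        rwa [ENNReal.toReal_mul, ENNReal.toReal_ofReal hζ0.le] at this)
      (fun n => by
        have h1 := ENNReal.mul_ne_top (a := ENNReal.ofReal ζ) ENNReal.ofReal_ne_top (hfin n)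
        have := ENNReal.toReal_mono (ENNReal.add_ne_top.2 ⟨h1, ENNReal.ofReal_ne_top⟩) (hupp n)
        rwa [ENNReal.toReal_add h1 ENNReal.ofReal_ne_top, ENNReal.toReal_mul,
          ENNReal.toReal_ofReal hζ0.le, ENNReal.toReal_ofReal (by positivity)] at this)
    -- Order `k = n + 1` corresponds to `stageHeight T lam n`, whence the extra factor `ζ⁻¹`.
    refine ⟨C * ζ⁻¹, by positivity, (tendsto_add_atTop_iff_nat 1).1 ?_⟩
    convert hlim.mul_const ζ⁻¹ using 2 with n
    rw [hmean, zpow_neg, zpow_natCast, mul_assoc, ← pow_succ, inv_pow]
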